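/- Let $\nu>0$ and let $H^\nu=L^2\big((-1,1),(1-x^2)^{\nu-1/2}dx\big)$ (complex-valued functions). Let $C_n^\nu$ be the Gegenbauer polynomials, $J_\mu(z)=\sum_{m\ge 0}\frac{(-1)^m}{m!\,\Gamma(\mu+m+1)}\left(\frac z2\right)^{\mu+2m}$ the Bessel function of order $\mu$ (principal branch of the power), and $(a)_n=a(a+1)\cdots(a+n-1)$. For $x\in(-1,1)$ and $t,s\in\mathbb R$ put $$K^\nu(x,t)=\sum_{n=0}^\infty i^n(\nu+n)\sqrt{\frac{2\,n!}{(2\nu)_n}}\;J_{\nu+n}(t)\,C_n^\nu(x),\qquad k^\nu(t,s)=\int_{-1}^1K^\nu(x,t)\overline{K^\nu(x,s)}\,(1-x^2)^{\nu-1/2}\,dx .$$ Let $u\in H^\nu$ and $f(t)=\int_{-1}^1u(x)K^\nu(x,t)(1-x^2)^{\nu-1/2}\,dx$ for $t\in\mathbb R$ (the integral converges). Then: 1. (Neumann series) For every $t\in\mathbb R$, $$f(t)=\sum_{n=0}^\infty a_nJ_{\nu+n}(t),\qquad a_n=i^n(\nu+n)\sqrt{\frac{2\,n!}{(2\nu)_n}}\int_{-1}^1u(x)\,C_n^\nu(x)\,(1-x^2)^{\nu-1/2}\,dx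 ,$$ with absolute convergence. 2. (Sampling formula) Let $(j_{\nu,n})_{n\ge0}$ be any enumeration without repetition of all the real zeros of $J_\nu$, that is, of the origin, the positive zeros and their negatives. Then, for every $t\in\mathbb R$, $$f(t)=\sum_{n=0}^\infty f(j_{\nu,n})\,\frac{k^\nu(t,j_{\nu,n})}{k^\nu(j_{\nu,n},j_{\nu,n})},$$ where $k^\nu(s,s)\ne0$ for every real $s\neq0$, and the term that belongs to the zero $0$, where numerator and denominator vanish, is understood as $\lim_{s\to0}f(s)\,k^\nu(t,s)/k^\nu(s,s)$ ($s$ real, $s\ne0$), which exists. The series converges absolutely for every $t$, and uniformly on every set of real $t$ on which $k^\nu(t,t)=\int_{-1}^1|K^\nu(x,t)|^2(1-x^2)^{\nu-1/2}dx$ is bounded. -/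

import Mathlib

open MeasureTheory Filter Topology

noncomputable section

/-- The Bessel function of the first kind `J_ν(z)` of real order `ν`, given by its power series;
the power `(z / 2) ^ (ν + 2 n)` is the principal branch. -/
def besselJ (ν : ℝ) (z : ℂ) : ℂ :=
  ∑' n : ℕ, ((-1 : ℂ) ^ n / ((n.factorial : ℂ) * ((Real.Gamma (ν + n + 1) : ℝ) : ℂ))) *
    (z / 2) ^ ((ν : ℂ) + 2 * (n : ℂ))

/-- The Pochhammer symbol `(a)_n = a (a + 1) ⋯ (a + n - 1)`. -/
def poch (a : ℝ) (n : ℕ) : ℝ := (ascPochhammer ℝ n).eval a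

/-- The Gegenbauer (ultraspherical) polynomial `C_n^ν(x)`. -/
def gegenbauerC (ν : ℝ) (n : ℕ) (x : ℝ) : ℝ :=
  ∑ m ∈ Finset.range (n / 2 + 1),
    (-1 : ℝ) ^ m * poch ν (n - m) / ((m.factorial : ℝ) * ((n - 2 * m).factorial : ℝ)) *
      (2 * x) ^ (n - 2 * m)

/-- The measure `(1 - x ^ 2) ^ (ν - 1 / 2) dx` on the interval `(-1, 1)`. -/
def gegenbauerMeasure (ν : ℝ) : Measure ℝ :=
  (volume.restrict (Set.Ioo (-1 : ℝ) 1)).withDensity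
    (fun x => ENNReal.ofReal ((1 - x ^ 2) ^ (ν - 1 / 2)))

/-- The factor `i ^ n (ν + n) √(2 n! / (2 ν)_n)`. -/
def neumannFactor (ν : ℝ) (n : ℕ) : ℂ :=
  Complex.I ^ n * ((ν + n : ℝ) : ℂ) *
    ((Real.sqrt (2 * (n.factorial : ℝ) / poch (2 * ν) n) : ℝ) : ℂ)

/-- The Gegenbauer–Bessel kernel
`K^ν(x, t) = ∑ i ^ n (ν + n) √(2 n! / (2 ν)_n) J_{ν + n}(t) C_n^ν(x)`. -/
def gegenbauerBesselKernel (ν x t : ℝ) : ℂ :=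
  ∑' n : ℕ, neumannFactor ν n * besselJ (ν + n) (t : ℂ) * ((gegenbauerC ν n x : ℝ) : ℂ)

/-- The kernel `k^ν(t, s) = ∫ K^ν(x, t) conj (K^ν(x, s)) (1 - x ^ 2) ^ (ν - 1 / 2) dx`
over `(-1, 1)`. -/
def reproducingKernel (ν t s : ℝ) : ℂ :=
  ∫ x, gegenbauerBesselKernel ν x t * (starRingEnd ℂ) (gegenbauerBesselKernel ν x s)
    ∂(gegenbauerMeasure ν)

/-- The set of all real zeros of `J_ν`: for `ν > 0` these are the origin, the positive zeros and
their negatives. -/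
def besselZeros (ν : ℝ) : Set ℝ := {τ : ℝ | besselJ ν (τ : ℂ) = 0}

end

noncomputable section

/-! The whole statement is transported to `ℓ²`. Write `J_{ν+n}(t) = (t/2)^ν y_n(t)` with `y_n(t)`
real (`besselSeq`), so that the branch of the power sits in one scalar. The factors in the kernel
are chosen so that, against the orthonormalized Gegenbauer polynomials, `K^ν(·, t)` has coefficients
`√c i^n (t/2)^ν V(t)_n` with `V(t)_n = √(2(ν+n)) y_n(t)` and a constant `c > 0` independent of `n`.
Hence `k^ν(t, s)` is `c` times the two prefactors (the second conjugated) times `⟨V(t), V(s)⟩`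
(`reproducingKernel_eq`), and `f(t) = √c (t/2)^ν ⟨V(t), β⟩` with `β` in `ℓ²` the rotated
Fourier-Gegenbauer coefficients of `u` (`integral_mul_kernel_eq`). The sampling formula is then the
expansion of `β` along the vectors `V(τ)`, `τ` a zero of `J_ν`, paired with `V(t)`.

It remains to see that these vectors form a complete orthogonal system. The recurrence `τ (y_n +
y_{n+2}) = 2(ν+n+1) y_{n+1}`, symmetrized by the weights, says that `V(τ)` is an eigenvector, with
eigenvalue `1/τ`, of a Jacobi matrix whose coupling between coordinates `0` and `1` is deleted; the
deletion is harmless exactly because `y_0(τ) = 0`. The zero `τ = 0` corresponds to the decoupled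
vector `e_0` and the eigenvalue `0`. The off-diagonal entries tend to `0`, so the operator is
compact and self-adjoint and its eigenvectors are complete. Conversely every eigenvector is in the
span of the `V(τ)` (`mem_span_of_besselOperator_eq`): a null solution of the recurrence is
proportional to `y` because their Casoratian is constant and tends to `0`.

Unconditional convergence in `ℓ²` gives absolute convergence of the scalar series, and
Cauchy-Schwarz makes the error at `t` at most `√(k^ν(t, t))` times an error independent of `t`. -/

/-! ### Reduced Bessel functions: bounds, recurrence, non-vanishing -/

/-- The entire function `(t / 2) ^ (-μ) J_μ(t)`, for real `t`. -/
def besselReduced (μ t : ℝ) : ℝ :=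
  ∑' m : ℕ, (-1 : ℝ) ^ m / ((m.factorial : ℝ) * Real.Gamma (μ + m + 1)) * (t / 2) ^ (2 * m)

/-- `(t / 2) ^ n` times the reduced Bessel function of order `ν + n`. -/
def besselSeq (ν : ℝ) (n : ℕ) (t : ℝ) : ℝ := (t / 2) ^ n * besselReduced (ν + n) t

lemma Gamma_le_Gamma_add_nat {μ : ℝ} (hμ : 0 ≤ μ) (m : ℕ) :
    Real.Gamma (μ + 1) ≤ Real.Gamma (μ + m + 1) := by
  induction m with
  | zero => simp
  | succ m ih =>
    have h : (0 : ℝ) < μ + m + 1 := by positivity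
    have e : μ + ((m + 1 : ℕ) : ℝ) + 1 = (μ + m + 1) + 1 := by push_cast; ring
    rw [e, Real.Gamma_add_one h.ne']
    have := Real.Gamma_pos_of_pos h
    have hm : (0 : ℝ) ≤ m := by positivity
    nlinarith

/-- Source of the factor `1 / n!` in the bounds of `besselSeq`, which beats every geometric growth
met later. -/
lemma factorial_mul_Gamma_le {μ : ℝ} (hμ : 0 ≤ μ) (m : ℕ) :
    (m.factorial : ℝ) * Real.Gamma (μ + 1) ≤ Real.Gamma (μ + m + 1) := by
  induction m with
  | zero => simp
  | succ m ih =>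
    have h : (0 : ℝ) < μ + m + 1 := by positivity
    have e : μ + ((m + 1 : ℕ) : ℝ) + 1 = (μ + m + 1) + 1 := by push_cast; ring
    rw [e, Real.Gamma_add_one h.ne', Nat.factorial_succ]
    push_cast
    have := Real.Gamma_pos_of_pos h
    have hm : (0 : ℝ) ≤ m := by positivity
    nlinarith

lemma norm_besselReduced_term_le {μ : ℝ} (hμ : 0 ≤ μ) (t : ℝ) (m : ℕ) :
    ‖(-1 : ℝ) ^ m / ((m.factorial : ℝ) * Real.Gamma (μ + m + 1)) * (t / 2) ^ (2 * m)‖ ≤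
      (Real.Gamma (μ + 1))⁻¹ * ((t / 2) ^ 2) ^ m / m.factorial := by
  have h1 : 0 < Real.Gamma (μ + 1) := Real.Gamma_pos_of_pos (by positivity)
  have h2 := Gamma_le_Gamma_add_nat hμ m
  have h3 : 0 < Real.Gamma (μ + m + 1) := h1.trans_le h2
  have h4 : (0 : ℝ) < m.factorial := by positivity
  rw [norm_mul, norm_div, norm_pow, norm_neg, norm_one, one_pow, pow_mul, Real.norm_of_nonneg
    (by positivity : 0 ≤ (m.factorial : ℝ) * Real.Gamma (μ + m + 1)),
    Real.norm_of_nonneg (by positivity : 0 ≤ ((t / 2) ^ 2) ^ m)]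
  rw [one_div, mul_inv, mul_div_assoc, mul_comm (m.factorial : ℝ)⁻¹, mul_assoc,
    mul_comm (m.factorial : ℝ)⁻¹, ← div_eq_mul_inv]
  gcongr

lemma summable_exp_term (c q : ℝ) : Summable fun m : ℕ => c * q ^ m / m.factorial := by
  simpa only [mul_div_assoc] using (Real.summable_pow_div_factorial q).mul_left c

lemma tsum_exp_term (c q : ℝ) : ∑' m : ℕ, c * q ^ m / m.factorial = c * Real.exp q := by
  simp only [mul_div_assoc]
  rw [tsum_mul_left, Real.exp_eq_exp_ℝ, NormedSpace.exp_eq_tsum_div]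

lemma summable_besselReduced {μ : ℝ} (hμ : 0 ≤ μ) (t : ℝ) : Summable fun m : ℕ =>
    (-1 : ℝ) ^ m / ((m.factorial : ℝ) * Real.Gamma (μ + m + 1)) * (t / 2) ^ (2 * m) :=
  Summable.of_norm_bounded (summable_exp_term _ _) (norm_besselReduced_term_le hμ t)

lemma abs_besselReduced_le {μ : ℝ} (hμ : 0 ≤ μ) (t : ℝ) :
    |besselReduced μ t| ≤ (Real.Gamma (μ + 1))⁻¹ * Real.exp ((t / 2) ^ 2) := by
  rw [← tsum_exp_term, ← Real.norm_eq_abs]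
  exact tsum_of_norm_bounded (summable_exp_term _ _).hasSum (norm_besselReduced_term_le hμ t)

/-- The three term recurrence of the reduced Bessel functions. -/
lemma besselReduced_recurrence {μ : ℝ} (hμ : 0 ≤ μ) (t : ℝ) :
    besselReduced μ t + (t / 2) ^ 2 * besselReduced (μ + 2) t =
      (μ + 1) * besselReduced (μ + 1) t := by
  have hs := summable_besselReduced hμ t
  have hs1 := (summable_besselReduced (by linarith : 0 ≤ μ + 1) t).mul_left (μ + 1)
  unfold besselReduced
  rw [← tsum_mul_left, ← tsum_mul_left, hs.tsum_eq_zero_add, hs1.tsum_eq_zero_add, add_assoc,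
    ← ((summable_nat_add_iff 1).2 hs).tsum_add
      ((summable_besselReduced (by linarith : 0 ≤ μ + 2) t).mul_left _)]
  have hp : μ + 1 ≠ 0 := by positivity
  have hG := (Real.Gamma_pos_of_pos (by linarith : 0 < μ + 1)).ne'
  congr 1
  · simp [Real.Gamma_add_one hp]
    field_simp
  · refine tsum_congr fun m => ?_
    have h : (0 : ℝ) < μ + m + 1 + 1 := by positivity
    have e1 : μ + ((m + 1 : ℕ) : ℝ) + 1 = μ + m + 1 + 1 := by push_cast; ring
    have e2 : μ + 2 + (m : ℝ) + 1 = μ + m + 1 + 1 + 1 := by ring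
    have e3 : μ + 1 + ((m + 1 : ℕ) : ℝ) + 1 = μ + m + 1 + 1 + 1 := by push_cast; ring
    rw [e1, e2, e3, Real.Gamma_add_one h.ne', Nat.factorial_succ]
    have h1 := (Real.Gamma_pos_of_pos h).ne'
    have h2 : (m.factorial : ℝ) ≠ 0 := by positivity
    have h3 : (m : ℝ) + 1 ≠ 0 := by positivity
    push_cast
    field_simp
    ring

lemma besselSeq_recurrence {ν : ℝ} (hν : 0 < ν) (n : ℕ) (t : ℝ) :
    t * (besselSeq ν n t + besselSeq ν (n + 2) t) =
      2 * (ν + (n + 1 : ℕ)) * besselSeq ν (n + 1) t := by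
  have h := besselReduced_recurrence (by positivity : 0 ≤ ν + n) t
  have e1 : ν + ((n + 1 : ℕ) : ℝ) = ν + n + 1 := by push_cast; ring
  have e2 : ν + ((n + 2 : ℕ) : ℝ) = ν + n + 2 := by push_cast; ring
  unfold besselSeq
  rw [e1, e2]
  linear_combination t * (t / 2) ^ n * h

lemma abs_besselSeq_le {ν : ℝ} (hν : 0 < ν) (n : ℕ) (t : ℝ) :
    |besselSeq ν n t| ≤
      (Real.Gamma (ν + 1))⁻¹ * Real.exp ((t / 2) ^ 2) * |t / 2| ^ n / n.factorial := by
  have h := abs_besselReduced_le (by positivity : 0 ≤ ν + n) t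
  have hG : 0 < Real.Gamma (ν + 1) := Real.Gamma_pos_of_pos (by positivity)
  have h1 : (Real.Gamma (ν + n + 1))⁻¹ ≤ (n.factorial * Real.Gamma (ν + 1))⁻¹ :=
    inv_anti₀ (by positivity) (factorial_mul_Gamma_le hν.le n)
  unfold besselSeq
  rw [abs_mul, abs_pow]
  calc |t / 2| ^ n * |besselReduced (ν + n) t|
      ≤ |t / 2| ^ n * ((n.factorial * Real.Gamma (ν + 1))⁻¹ * Real.exp ((t / 2) ^ 2)) := by
        gcongr
        exact h.trans (by gcongr)
    _ = _ := by rw [mul_inv]; ring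

lemma abs_besselSeq_le_of_abs_le {ν : ℝ} (hν : 0 < ν) (n : ℕ) {t R : ℝ} (ht : |t| ≤ R) :
    |besselSeq ν n t| ≤
      (Real.Gamma (ν + 1))⁻¹ * Real.exp ((R / 2) ^ 2) * (R / 2) ^ n / n.factorial := by
  refine (abs_besselSeq_le hν n t).trans ?_
  have hG : 0 < Real.Gamma (ν + 1) := Real.Gamma_pos_of_pos (by positivity)
  have h : |t / 2| ≤ R / 2 := by rw [abs_div, abs_two]; gcongr
  rw [← sq_abs (t / 2)]
  gcongr

/-- `besselSeq ν n t` decays in `n` faster than every geometric sequence. -/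
lemma summable_geometric_mul_besselSeq {ν : ℝ} (hν : 0 < ν) (B t : ℝ) (hB : 0 ≤ B) :
    Summable fun n : ℕ => B ^ n * |besselSeq ν n t| := by
  refine Summable.of_nonneg_of_le (fun n => by positivity) (fun n => ?_)
    (summable_exp_term ((Real.Gamma (ν + 1))⁻¹ * Real.exp ((t / 2) ^ 2)) (B * |t / 2|))
  calc B ^ n * |besselSeq ν n t| ≤ B ^ n * ((Real.Gamma (ν + 1))⁻¹ * Real.exp ((t / 2) ^ 2) *
        |t / 2| ^ n / n.factorial) := by gcongr; exact abs_besselSeq_le hν n t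
    _ = _ := by rw [mul_pow]; ring

lemma continuousOn_besselReduced {μ : ℝ} (hμ : 0 ≤ μ) (R : ℝ) :
    ContinuousOn (besselReduced μ) (Set.Icc (-R) R) := by
  unfold besselReduced
  refine continuousOn_tsum (u := fun m => (Real.Gamma (μ + 1))⁻¹ * ((R / 2) ^ 2) ^ m / m.factorial)
    (fun m => by fun_prop) (summable_exp_term (Real.Gamma (μ + 1))⁻¹ ((R / 2) ^ 2))
    (fun m t ht => ?_)
  refine (norm_besselReduced_term_le hμ t m).trans ?_
  have hG : 0 < Real.Gamma (μ + 1) := Real.Gamma_pos_of_pos (by positivity)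
  have : (t / 2) ^ 2 ≤ (R / 2) ^ 2 := by
    have h1 := ht.1
    have h2 := ht.2
    nlinarith
  gcongr

lemma continuous_besselReduced {μ : ℝ} (hμ : 0 ≤ μ) : Continuous (besselReduced μ) := by
  refine continuous_iff_continuousAt.2 fun t => ?_
  refine (continuousOn_besselReduced hμ (|t| + 1)).continuousAt (Icc_mem_nhds ?_ ?_)
  · linarith [neg_abs_le t]
  · linarith [le_abs_self t]

lemma continuous_besselSeq {ν : ℝ} (hν : 0 < ν) (n : ℕ) : Continuous (besselSeq ν n) := by
  have := continuous_besselReduced (by positivity : 0 ≤ ν + n)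
  unfold besselSeq
  fun_prop

/-- For large order the constant term dominates the power series, since each later term gains at
least a factor `1 / (μ + 1)`. This rules out zeros at a fixed `t` once the order is large. -/
lemma abs_Gamma_mul_besselReduced_sub_one_le {μ : ℝ} (hμ : 0 ≤ μ) (t : ℝ) :
    |Real.Gamma (μ + 1) * besselReduced μ t - 1| ≤
      (μ + 1)⁻¹ * ((t / 2) ^ 2 * Real.exp ((t / 2) ^ 2)) := by
  have hG : 0 < Real.Gamma (μ + 1) := Real.Gamma_pos_of_pos (by positivity)
  unfold besselReduced
  rw [(summable_besselReduced hμ t).tsum_eq_zero_add, mul_add, ← tsum_mul_left]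
  have e : Real.Gamma (μ + 1) * ((-1 : ℝ) ^ 0 / (((0 : ℕ).factorial : ℝ) *
      Real.Gamma (μ + (0 : ℕ) + 1)) * (t / 2) ^ (2 * 0)) = 1 := by simp [hG.ne']
  rw [e, add_sub_cancel_left, ← mul_assoc, ← tsum_exp_term, ← Real.norm_eq_abs]
  refine tsum_of_norm_bounded (summable_exp_term _ _).hasSum fun m => ?_
  have hm : (0 : ℝ) < μ + 1 + 1 := by linarith
  have h1 := Gamma_le_Gamma_add_nat (by linarith : 0 ≤ μ + 1) m
  rw [Real.Gamma_add_one (by positivity)] at h1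
  have e1 : μ + ((m + 1 : ℕ) : ℝ) + 1 = μ + 1 + m + 1 := by push_cast; ring
  have h2 : 0 < Real.Gamma (μ + 1 + m + 1) := Real.Gamma_pos_of_pos (by positivity)
  have h3 : (m.factorial : ℝ) ≤ ((m + 1).factorial : ℕ) := by
    exact_mod_cast Nat.factorial_le (Nat.le_succ m)
  rw [e1, norm_mul, norm_mul, norm_div, norm_pow, norm_neg, norm_one, one_pow, pow_mul,
    Real.norm_of_nonneg hG.le, Real.norm_of_nonneg
    (by positivity : 0 ≤ ((m + 1).factorial : ℝ) * Real.Gamma (μ + 1 + m + 1)),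
    Real.norm_of_nonneg (by positivity : 0 ≤ ((t / 2) ^ 2) ^ (m + 1))]
  have h4 : 1 / (((m + 1).factorial : ℝ) * Real.Gamma (μ + 1 + m + 1)) ≤
      1 / ((m.factorial : ℝ) * ((μ + 1) * Real.Gamma (μ + 1))) := by gcongr
  calc _ ≤ Real.Gamma (μ + 1) * (1 / ((m.factorial : ℝ) * ((μ + 1) * Real.Gamma (μ + 1))) *
        ((t / 2) ^ 2) ^ (m + 1)) := by gcongr
    _ = _ := by field_simp; ring

/-- At a point `t ≠ 0` not all the Bessel functions `J_{ν + n}` vanish. -/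
lemma exists_besselSeq_ne_zero {ν : ℝ} (hν : 0 < ν) {t : ℝ} (ht : t ≠ 0) :
    ∀ N : ℕ, ∃ n ≥ N, besselSeq ν n t ≠ 0 := by
  intro N
  -- Beyond this order the normalized series differs from `1` by less than `1`.
  obtain ⟨n, hn⟩ := exists_nat_gt ((t / 2) ^ 2 * Real.exp ((t / 2) ^ 2))
  refine ⟨max n N, le_max_right _ _, fun h => ?_⟩
  have hle : (n : ℝ) ≤ (max n N : ℕ) := by exact_mod_cast le_max_left _ _
  have h0 : besselReduced (ν + (max n N : ℕ)) t = 0 := by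
    unfold besselSeq at h
    exact (mul_eq_zero.1 h).resolve_left (pow_ne_zero _ (by simpa using ht))
  have := abs_Gamma_mul_besselReduced_sub_one_le (by positivity : 0 ≤ ν + (max n N : ℕ)) t
  rw [h0, mul_zero, zero_sub, abs_neg, abs_one, inv_mul_eq_div, le_div_iff₀ (by positivity)] at this
  linarith

/-- Two consecutive zeros would propagate upwards through the recurrence to all higher orders. -/
lemma besselSeq_pair_ne_zero {ν : ℝ} (hν : 0 < ν) {t : ℝ} (ht : t ≠ 0) (N : ℕ)
    (h0 : besselSeq ν N t = 0) : besselSeq ν (N + 1) t ≠ 0 := by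
  intro h1
  have key : ∀ k, besselSeq ν (N + k) t = 0 ∧ besselSeq ν (N + k + 1) t = 0 := by
    intro k
    induction k with
    | zero => exact ⟨h0, h1⟩
    | succ k ih =>
      refine ⟨ih.2, ?_⟩
      have h := besselSeq_recurrence hν (N + k) t
      rw [ih.1, ih.2, mul_zero, zero_add] at h
      exact (mul_eq_zero.1 h).resolve_left ht
  obtain ⟨n, hn, hne⟩ := exists_besselSeq_ne_zero hν ht N
  obtain ⟨k, rfl⟩ := Nat.exists_eq_add_of_le hn
  exact hne (key k).1

lemma besselSeq_at_zero (ν : ℝ) (n : ℕ) :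
    besselSeq ν n 0 = if n = 0 then (Real.Gamma (ν + 1))⁻¹ else 0 := by
  split_ifs with h
  · subst h
    unfold besselSeq besselReduced
    rw [tsum_eq_single 0 (fun m hm => by simp [hm])]
    simp
  · simp [besselSeq, h]

/-- On the real line `J_{ν + n}(t) = (t / 2) ^ ν · besselSeq ν n t`. -/
lemma besselJ_eq {ν : ℝ} (hν : 0 < ν) (n : ℕ) (t : ℝ) :
    besselJ (ν + n) (t : ℂ) = ((t : ℂ) / 2) ^ (ν : ℂ) * ((besselSeq ν n t : ℝ) : ℂ) := by
  unfold besselJ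
  -- At the origin powers cannot be split, but `ν > 0` makes both sides vanish.
  rcases eq_or_ne t 0 with rfl | ht
  · have h0 : (ν : ℂ) ≠ 0 := by exact_mod_cast hν.ne'
    have hterm : ∀ m : ℕ, (((ν + n : ℝ) : ℂ) + 2 * (m : ℂ)) ≠ 0 := by
      intro m
      have : (0 : ℝ) < (ν + n : ℝ) + 2 * (m : ℝ) := by positivity
      exact_mod_cast this.ne'
    simp only [Complex.ofReal_zero, zero_div, Complex.zero_cpow h0, Complex.zero_cpow (hterm _)]
    simp
  · have h2 : ((t : ℂ) / 2) ≠ 0 := by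
      have : (t : ℂ) ≠ 0 := by exact_mod_cast ht
      simpa using this
    unfold besselSeq besselReduced
    push_cast
    rw [← tsum_mul_left, ← tsum_mul_left]
    refine tsum_congr fun m => ?_
    rw [Complex.cpow_add _ _ h2, Complex.cpow_add _ _ h2]
    have e : (2 * (m : ℂ)) = ((2 * m : ℕ) : ℂ) := by push_cast; ring
    rw [e, Complex.cpow_natCast, Complex.cpow_natCast]
    ring

/-- The origin is a zero only through the prefactor `(t / 2) ^ ν`; all other zeros come from the
reduced function, which does not vanish at `0`. -/
lemma mem_besselZeros_iff {ν : ℝ} (hν : 0 < ν) (τ : ℝ) :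
    τ ∈ besselZeros ν ↔ τ = 0 ∨ besselSeq ν 0 τ = 0 := by
  have h := besselJ_eq hν 0 τ
  simp only [Nat.cast_zero, add_zero] at h
  simp only [besselZeros, Set.mem_ofPred_eq, h, mul_eq_zero, Complex.cpow_eq_zero_iff,
    div_eq_zero_iff, Complex.ofReal_eq_zero]
  have : ν ≠ 0 := hν.ne'
  simp [this]

/-! ### Gegenbauer polynomials: differential equation and recurrence -/

/-- The coefficient of `x ^ k` in the Gegenbauer polynomial of degree `k + 2 * m`. -/
def gegenbauerCoeff (ν : ℝ) (m k : ℕ) : ℝ :=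
  (-1 : ℝ) ^ m * poch ν (m + k) / ((m.factorial : ℝ) * (k.factorial : ℝ)) * 2 ^ k

/-- The Gegenbauer polynomial as an element of `ℝ[X]`. -/
def gegenbauerPoly (ν : ℝ) (n : ℕ) : Polynomial ℝ :=
  ∑ m ∈ Finset.range (n / 2 + 1), Polynomial.monomial (n - 2 * m) (gegenbauerCoeff ν m (n - 2 * m))

lemma poch_succ (a : ℝ) (n : ℕ) : poch a (n + 1) = poch a n * (a + n) := by
  simp [poch, ascPochhammer_succ_eval]

lemma poch_zero (a : ℝ) : poch a 0 = 1 := by simp [poch]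

lemma poch_pos {a : ℝ} (ha : 0 < a) (n : ℕ) : 0 < poch a n := ascPochhammer_pos n a ha

lemma gegenbauerPoly_eval (ν : ℝ) (n : ℕ) (x : ℝ) :
    (gegenbauerPoly ν n).eval x = gegenbauerC ν n x := by
  unfold gegenbauerPoly gegenbauerC gegenbauerCoeff
  rw [Polynomial.eval_finsetSum]
  refine Finset.sum_congr rfl fun m hm => ?_
  have hm' : 2 * m ≤ n := by have := Finset.mem_range.1 hm; omega
  have e : m + (n - 2 * m) = n - m := by omega
  rw [Polynomial.eval_monomial, e, mul_pow]
  ring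

lemma gegenbauerPoly_coeff (ν : ℝ) (m k : ℕ) :
    (gegenbauerPoly ν (k + 2 * m)).coeff k = gegenbauerCoeff ν m k := by
  unfold gegenbauerPoly
  rw [Polynomial.finsetSum_coeff, Finset.sum_eq_single m]
  · simp
  · intro m' hm' hne
    have := Finset.mem_range.1 hm'
    rw [Polynomial.coeff_monomial, if_neg (by omega)]
  · intro h
    exact absurd (Finset.mem_range.2 (by omega)) h

lemma gegenbauerPoly_coeff_eq_zero (ν : ℝ) {n k : ℕ} (h : ¬ ∃ m, n = k + 2 * m) :
    (gegenbauerPoly ν n).coeff k = 0 := by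
  unfold gegenbauerPoly
  rw [Polynomial.finsetSum_coeff]
  refine Finset.sum_eq_zero fun m hm => ?_
  have := Finset.mem_range.1 hm
  rw [Polynomial.coeff_monomial, if_neg]
  intro e
  exact h ⟨m, by omega⟩

lemma gegenbauerCoeff_diff (ν : ℝ) (m k : ℕ) :
    (k + 1) * (k + 2) * gegenbauerCoeff ν m (k + 2) =
      -(4 * (m + 1) * (ν + (m + 1 + k : ℕ))) * gegenbauerCoeff ν (m + 1) k := by
  unfold gegenbauerCoeff
  have e1 : m + (k + 2) = (m + 1 + k) + 1 := by ring
  rw [e1, poch_succ ν (m + 1 + k), Nat.factorial_succ m, Nat.factorial_succ (k + 1),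
    Nat.factorial_succ k]
  have h1 : (m.factorial : ℝ) ≠ 0 := by positivity
  have h2 : (k.factorial : ℝ) ≠ 0 := by positivity
  have h3 : (m : ℝ) + 1 ≠ 0 := by positivity
  have h4 : (k : ℝ) + 1 ≠ 0 := by positivity
  have h5 : (k : ℝ) + 1 + 1 ≠ 0 := by positivity
  push_cast
  field_simp
  ring

open Polynomial in
/-- The Gegenbauer differential equation. -/
lemma gegenbauerPoly_ode (ν : ℝ) (n : ℕ) :
    (1 - X ^ 2) * derivative (derivative (gegenbauerPoly ν n)) -
      C (2 * ν + 1) * (X * derivative (gegenbauerPoly ν n)) +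
      C (n * (n + 2 * ν)) * gegenbauerPoly ν n = 0 := by
  -- The differential equation read off at the coefficient of `x ^ k`.
  have key : ∀ k : ℕ, ((k : ℝ) + 1) * (k + 2) * (gegenbauerPoly ν n).coeff (k + 2) +
      (n * (n + 2 * ν) - k * (k + 2 * ν)) * (gegenbauerPoly ν n).coeff k = 0 := by
    intro k
    by_cases h : ∃ m, n = k + 2 * m
    · obtain ⟨m, rfl⟩ := h
      rw [gegenbauerPoly_coeff]
      cases m with
      | zero =>
        rw [gegenbauerPoly_coeff_eq_zero ν (k := k + 2) (by rintro ⟨m, hm⟩; omega)]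
        simp
      | succ m =>
        have e : k + 2 * (m + 1) = (k + 2) + 2 * m := by ring
        have h1 : (gegenbauerPoly ν (k + 2 * (m + 1))).coeff (k + 2) =
            gegenbauerCoeff ν m (k + 2) := by rw [e, gegenbauerPoly_coeff]
        rw [h1, gegenbauerCoeff_diff]
        push_cast
        ring
    · rw [gegenbauerPoly_coeff_eq_zero ν h,
        gegenbauerPoly_coeff_eq_zero ν (k := k + 2) (fun ⟨m, hm⟩ => h ⟨m + 1, by omega⟩)]
      ring
  ext k
  have hk := key k
  rw [coeff_zero, coeff_add, coeff_sub, coeff_C_mul, coeff_C_mul, sub_mul, one_mul, coeff_sub]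
  rcases k with _ | _ | k
  · simp [coeff_derivative] at hk ⊢
    linarith
  · simp [coeff_derivative, coeff_X_pow_mul', coeff_X_mul] at hk ⊢
    linarith
  · simp [coeff_derivative, coeff_X_pow_mul', coeff_X_mul] at hk ⊢
    linarith

/-- This lemma and the next two are the three-term recurrence on coefficients: at the constant term,
where the multiplication by `x` contributes nothing; at the leading term, where the polynomial of
lowest degree contributes nothing; and in between. -/
lemma gegenbauerCoeff_recurrence_left (ν : ℝ) (m : ℕ) :
    (2 * m + 2 : ℝ) * gegenbauerCoeff ν (m + 1) 0 = -(2 * m + 2 * ν) * gegenbauerCoeff ν m 0 := by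
  unfold gegenbauerCoeff
  have h1 : (m.factorial : ℝ) ≠ 0 := by positivity
  have h3 : (m : ℝ) + 1 ≠ 0 := by positivity
  simp only [add_zero, poch_succ, Nat.factorial_succ]
  push_cast
  field_simp
  ring

lemma gegenbauerCoeff_recurrence_top (ν : ℝ) (k : ℕ) :
    (k + 1 : ℝ) * gegenbauerCoeff ν 0 (k + 1) = 2 * (k + ν) * gegenbauerCoeff ν 0 k := by
  unfold gegenbauerCoeff
  have h1 : (k.factorial : ℝ) ≠ 0 := by positivity
  have h3 : (k : ℝ) + 1 ≠ 0 := by positivity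
  simp only [zero_add, poch_succ, Nat.factorial_succ]
  push_cast
  field_simp
  ring

lemma gegenbauerCoeff_recurrence (ν : ℝ) (m k : ℕ) :
    (k + 1 + 2 * (m + 1) : ℝ) * gegenbauerCoeff ν (m + 1) (k + 1) =
      2 * (k + 2 * (m + 1) + ν) * gegenbauerCoeff ν (m + 1) k -
        (k + 1 + 2 * m + 2 * ν) * gegenbauerCoeff ν m (k + 1) := by
  unfold gegenbauerCoeff
  have e1 : m + 1 + (k + 1) = m + k + 1 + 1 := by ring
  have e2 : m + 1 + k = m + k + 1 := by ring
  have e3 : m + (k + 1) = m + k + 1 := by ring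
  have h1 : (m.factorial : ℝ) ≠ 0 := by positivity
  have h2 : (k.factorial : ℝ) ≠ 0 := by positivity
  have h3 : (m : ℝ) + 1 ≠ 0 := by positivity
  have h4 : (k : ℝ) + 1 ≠ 0 := by positivity
  rw [e1, e2, e3, poch_succ ν (m + k + 1)]
  simp only [Nat.factorial_succ]
  push_cast
  field_simp
  ring

open Polynomial in
/-- The three term recurrence of the Gegenbauer polynomials. -/
lemma gegenbauerPoly_recurrence (ν : ℝ) (n : ℕ) :
    C ((n + 2 : ℕ) : ℝ) * gegenbauerPoly ν (n + 2) =
      C (2 * ((n + 1 : ℕ) + ν)) * (X * gegenbauerPoly ν (n + 1)) -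
        C (n + 2 * ν) * gegenbauerPoly ν n := by
  ext k
  rw [coeff_sub, coeff_C_mul, coeff_C_mul, coeff_C_mul]
  by_cases h : ∃ m, n + 2 = k + 2 * m
  · obtain ⟨m, hm⟩ := h
    rcases k with _ | k
    · obtain ⟨m, rfl⟩ : ∃ l, m = l + 1 := ⟨m - 1, by omega⟩
      obtain rfl : n = 0 + 2 * m := by omega
      have e : 0 + 2 * m + 2 = 0 + 2 * (m + 1) := by ring
      have h2 : (gegenbauerPoly ν (0 + 2 * m + 2)).coeff 0 = gegenbauerCoeff ν (m + 1) 0 := by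
        rw [e, gegenbauerPoly_coeff]
      rw [h2, gegenbauerPoly_coeff, mul_coeff_zero, coeff_X_zero]
      have := gegenbauerCoeff_recurrence_left ν m
      push_cast
      linarith
    · rw [coeff_X_mul]
      have h1 : (gegenbauerPoly ν (n + 1)).coeff k = gegenbauerCoeff ν m k := by
        rw [show n + 1 = k + 2 * m by omega, gegenbauerPoly_coeff]
      have h2 : (gegenbauerPoly ν (n + 2)).coeff (k + 1) = gegenbauerCoeff ν m (k + 1) := by
        rw [hm, gegenbauerPoly_coeff]
      rw [h1, h2]
      rcases m with _ | m
      · rw [gegenbauerPoly_coeff_eq_zero ν (n := n) (k := k + 1) (by rintro ⟨m, hm⟩; omega)]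
        have e : ((n + 2 : ℕ) : ℝ) = k + 1 := by rw [hm]; push_cast; ring
        have e' : ((n + 1 : ℕ) : ℝ) = k := by exact_mod_cast (by omega : n + 1 = k)
        rw [e, e', gegenbauerCoeff_recurrence_top]
        ring
      · obtain rfl : n = k + 1 + 2 * m := by omega
        rw [gegenbauerPoly_coeff]
        have := gegenbauerCoeff_recurrence ν m k
        push_cast
        linear_combination this
  · rw [gegenbauerPoly_coeff_eq_zero ν h,
      gegenbauerPoly_coeff_eq_zero ν (n := n) (k := k) (fun ⟨m, hm⟩ => h ⟨m + 1, by omega⟩)]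
    rcases k with _ | k
    · simp
    · rw [coeff_X_mul, gegenbauerPoly_coeff_eq_zero ν (n := n + 1) (k := k)
        (fun ⟨m, hm⟩ => h ⟨m, by omega⟩)]
      ring

lemma gegenbauerPoly_zero (ν : ℝ) : gegenbauerPoly ν 0 = 1 := by
  simp [gegenbauerPoly, gegenbauerCoeff, poch_zero]

lemma gegenbauerPoly_one (ν : ℝ) :
    gegenbauerPoly ν 1 = Polynomial.C (2 * ν) * Polynomial.X := by
  simp [gegenbauerPoly, gegenbauerCoeff, poch_succ, poch_zero, ← Polynomial.C_mul_X_eq_monomial,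
    mul_comm ν]

/-- A crude geometric bound of the Gegenbauer polynomials on `[-1, 1]`. -/
lemma abs_gegenbauerC_le {ν : ℝ} (hν : 0 < ν) {x : ℝ} (hx : |x| ≤ 1) (n : ℕ) :
    |gegenbauerC ν n x| ≤ (3 + 4 * ν) ^ n := by
  induction n using Nat.strong_induction_on with
  | _ n ih =>
    rcases n with _ | _ | n
    · simp [← gegenbauerPoly_eval, gegenbauerPoly_zero]
    · simp only [← gegenbauerPoly_eval, zero_add, gegenbauerPoly_one, Polynomial.eval_mul,
        Polynomial.eval_C, Polynomial.eval_X, abs_mul, pow_one]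
      rw [abs_of_pos hν, abs_two]
      nlinarith
    · have h0 := ih n (by omega)
      have h1 := ih (n + 1) (by omega)
      have hr := congrArg (Polynomial.eval x) (gegenbauerPoly_recurrence ν n)
      simp only [Polynomial.eval_mul, Polynomial.eval_sub, Polynomial.eval_C, Polynomial.eval_X,
        gegenbauerPoly_eval] at hr
      have hn : (0 : ℝ) ≤ n := by positivity
      -- Any base works that covers degree one, `2 ν ≤ B`, and closes the induction, `2 (n + 1 + ν)
      -- B + n + 2 ν ≤ (n + 2) B ^ 2`.
      set B := 3 + 4 * ν with hB
      have hBn : 0 < B ^ n := by positivity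
      have h2 : |((n + 2 : ℕ) : ℝ) * gegenbauerC ν (n + 1 + 1) x| ≤
          2 * ((n + 1 : ℕ) + ν) * B ^ (n + 1) + (n + 2 * ν) * B ^ n := by
        rw [hr]
        refine (abs_sub _ _).trans ?_
        rw [abs_mul _ (x * _), abs_mul _ (gegenbauerC ν n x), abs_mul x,
          abs_of_nonneg (by positivity : 0 ≤ 2 * (((n + 1 : ℕ) : ℝ) + ν)),
          abs_of_nonneg (by positivity : 0 ≤ (n : ℝ) + 2 * ν)]
        gcongr
        calc |x| * |gegenbauerC ν (n + 1) x| ≤ 1 * |gegenbauerC ν (n + 1) x| := by gcongr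
          _ ≤ _ := by linarith
      rw [abs_mul, abs_of_nonneg (by positivity)] at h2
      have h3 : 2 * ((n + 1 : ℕ) + ν) * B ^ (n + 1) + (n + 2 * ν) * B ^ n ≤
          ((n + 2 : ℕ) : ℝ) * B ^ (n + 2) := by
        have : 2 * ((n + 1 : ℕ) + ν) * B + (n + 2 * ν) ≤ ((n + 2 : ℕ) : ℝ) * B ^ 2 := by
          push_cast
          rw [hB]
          nlinarith [mul_nonneg hn hν.le, mul_pos hν hν, mul_nonneg hn (mul_pos hν hν).le]
        calc _ = (2 * ((n + 1 : ℕ) + ν) * B + (n + 2 * ν)) * B ^ n := by ring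
          _ ≤ ((n + 2 : ℕ) : ℝ) * B ^ 2 * B ^ n := by gcongr
          _ = _ := by ring
      exact le_of_mul_le_mul_left (h2.trans h3) (by positivity)

lemma continuous_gegenbauerC (ν : ℝ) (n : ℕ) : Continuous (gegenbauerC ν n) := by
  have : gegenbauerC ν n = fun x => (gegenbauerPoly ν n).eval x :=
    funext fun x => (gegenbauerPoly_eval ν n x).symm
  rw [this]
  exact (gegenbauerPoly ν n).continuous

/-! ### The Gegenbauer weight, orthogonality and norms -/

/-- With `a = ν - 1/2 > -1` the weight is at most `1 + (1 - x) ^ a + (1 + x) ^ a`: it is at most `1`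
for `a ≥ 0`, and for `a ≤ 0` only the nearer endpoint matters. -/
lemma integrableOn_gegenbauerWeight {ν : ℝ} (hν : 0 < ν) :
    IntegrableOn (fun x : ℝ => (1 - x ^ 2) ^ (ν - 1 / 2)) (Set.Ioo (-1) 1) := by
  have ha : -1 < ν - 1 / 2 := by linarith
  have h0 : IntervalIntegrable (fun x : ℝ => x ^ (ν - 1 / 2)) volume 0 2 :=
    intervalIntegral.intervalIntegrable_rpow' ha
  have h1 : IntegrableOn (fun x : ℝ => (1 - x) ^ (ν - 1 / 2)) (Set.Ioo (-1) 1) := by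
    have := (h0.comp_sub_left 1).symm
    norm_num at this
    rw [intervalIntegrable_iff_integrableOn_Ioo_of_le (by norm_num)] at this
    exact this
  have h2 : IntegrableOn (fun x : ℝ => (1 + x) ^ (ν - 1 / 2)) (Set.Ioo (-1) 1) := by
    have := (h0.comp_add_left 1)
    norm_num at this
    rw [intervalIntegrable_iff_integrableOn_Ioo_of_le (by norm_num)] at this
    exact this
  have h3 : IntegrableOn (fun _ : ℝ => (1 : ℝ)) (Set.Ioo (-1) 1) := by
    simp [IntegrableOn]
  refine Integrable.mono' ((h3.add h1).add h2) (Measurable.aestronglyMeasurable (by fun_prop)) ?_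
  refine (ae_restrict_iff' measurableSet_Ioo).2 (Eventually.of_forall fun x hx => ?_)
  have hx1 : 0 < 1 - x := by linarith [hx.2]
  have hx2 : 0 < 1 + x := by linarith [hx.1]
  have hx3 : 0 < 1 - x ^ 2 := by nlinarith
  have p1 : 0 < (1 - x) ^ (ν - 1 / 2) := Real.rpow_pos_of_pos hx1 _
  have p2 : 0 < (1 + x) ^ (ν - 1 / 2) := Real.rpow_pos_of_pos hx2 _
  rw [Real.norm_of_nonneg (Real.rpow_nonneg hx3.le _)]
  simp only [Pi.add_apply]
  rcases le_total 0 (ν - 1 / 2) with h | h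
  · have := Real.rpow_le_one hx3.le (by nlinarith) h
    linarith
  · rcases le_total 0 x with hx0 | hx0
    · have := Real.rpow_le_rpow_of_nonpos hx1 (by nlinarith : 1 - x ≤ 1 - x ^ 2) h
      linarith
    · have := Real.rpow_le_rpow_of_nonpos hx2 (by nlinarith : 1 + x ≤ 1 - x ^ 2) h
      linarith

lemma isFiniteMeasure_gegenbauerMeasure {ν : ℝ} (hν : 0 < ν) :
    IsFiniteMeasure (gegenbauerMeasure ν) :=
  isFiniteMeasure_withDensity_ofReal (integrableOn_gegenbauerWeight hν).2

lemma ae_gegenbauerMeasure_mem (ν : ℝ) : ∀ᵐ x ∂(gegenbauerMeasure ν), x ∈ Set.Ioo (-1 : ℝ) 1 :=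
  (withDensity_absolutelyContinuous _ _).ae_le (ae_restrict_mem measurableSet_Ioo)

lemma ae_gegenbauerMeasure_abs_le (ν : ℝ) : ∀ᵐ x ∂(gegenbauerMeasure ν), |x| ≤ 1 := by
  filter_upwards [ae_gegenbauerMeasure_mem ν] with x hx
  exact abs_le.2 ⟨hx.1.le, hx.2.le⟩

lemma integral_gegenbauerMeasure (ν : ℝ) (g : ℝ → ℝ) :
    ∫ x, g x ∂(gegenbauerMeasure ν) =
      ∫ x in Set.Ioo (-1 : ℝ) 1, (1 - x ^ 2) ^ (ν - 1 / 2) * g x := by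
  unfold gegenbauerMeasure
  rw [integral_withDensity_eq_integral_toReal_smul (by fun_prop)
    (Eventually.of_forall fun x => ENNReal.ofReal_lt_top)]
  refine setIntegral_congr_fun measurableSet_Ioo fun x hx => ?_
  have : 0 ≤ 1 - x ^ 2 := by nlinarith [hx.1, hx.2]
  simp [ENNReal.toReal_ofReal (Real.rpow_nonneg this _)]

/-- A continuous function is bounded on `[-1, 1]`, hence integrable. -/
lemma Continuous.integrable_gegenbauerMeasure {E : Type*} [NormedAddCommGroup E]
    {ν : ℝ} (hν : 0 < ν) {g : ℝ → E} (hg : Continuous g)  :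
    Integrable g (gegenbauerMeasure ν) := by
  have := isFiniteMeasure_gegenbauerMeasure hν
  obtain ⟨C, hC⟩ := (isCompact_Icc : IsCompact (Set.Icc (-1 : ℝ) 1)).exists_bound_of_continuousOn
    hg.continuousOn
  refine Integrable.of_bound hg.aestronglyMeasurable C ?_
  filter_upwards [ae_gegenbauerMeasure_mem ν] with x hx
  exact hC x ⟨hx.1.le, hx.2.le⟩

open Polynomial in
/-- Integration by parts against the Gegenbauer weight. -/
lemma integral_gegenbauerMeasure_by_parts {ν : ℝ} (hν : 0 < ν) (p : ℝ[X]) :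
    ∫ x, ((1 - X ^ 2) * derivative p - C (2 * ν + 1) * (X * p)).eval x
      ∂(gegenbauerMeasure ν) = 0 := by
  rw [integral_gegenbauerMeasure]
  have hint : IntervalIntegrable (fun x => (1 - x ^ 2) ^ (ν - 1 / 2) *
      ((1 - X ^ 2) * derivative p - C (2 * ν + 1) * (X * p)).eval x) volume (-1) 1 := by
    have h := integrableOn_gegenbauerWeight hν
    refine IntervalIntegrable.mul_continuousOn ?_ (Polynomial.continuous _).continuousOn
    rwa [intervalIntegrable_iff_integrableOn_Ioo_of_le (by norm_num)]
  -- The antiderivative `(1 - x ^ 2) ^ (ν + 1/2) p(x)` vanishes at both endpoints because `ν + 1/2 >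
  -- 0`.
  rw [← integral_Ioc_eq_integral_Ioo, ← intervalIntegral.integral_of_le (by norm_num),
    intervalIntegral.integral_eq_sub_of_hasDerivAt_of_le (by norm_num)
      (f := fun x => (1 - x ^ 2) ^ (ν + 1 / 2) * p.eval x) _ _ hint]
  · have : ν + 1 / 2 ≠ 0 := by positivity
    norm_num [Real.zero_rpow this]
  · refine ContinuousOn.mul (ContinuousOn.rpow_const (by fun_prop) fun x _ => ?_)
      p.continuous.continuousOn
    right
    positivity
  · intro x hx
    have hx3 : 0 < 1 - x ^ 2 := by nlinarith [hx.1, hx.2]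
    have h1 : HasDerivAt (fun x : ℝ => 1 - x ^ 2) (-(2 * x)) x := by
      simpa using (hasDerivAt_pow 2 x).const_sub 1
    have h2 := (h1.rpow_const (p := ν + 1 / 2) (Or.inl hx3.ne')).mul (p.hasDerivAt x)
    refine h2.congr_deriv ?_
    have e : (1 - x ^ 2) ^ (ν + 1 / 2) = (1 - x ^ 2) ^ (ν - 1 / 2) * (1 - x ^ 2) := by
      rw [← Real.rpow_add_one hx3.ne']
      congr 1
      ring
    rw [e, show ν + 1 / 2 - 1 = ν - 1 / 2 by ring]
    simp
    ring

/-- The integral of a polynomial against the Gegenbauer weight, as a linear functional. -/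
def gegenbauerFunctional {ν : ℝ} (hν : 0 < ν) : Polynomial ℝ →ₗ[ℝ] ℝ where
  toFun p := ∫ x, p.eval x ∂(gegenbauerMeasure ν)
  map_add' p q := by
    simp only [Polynomial.eval_add]
    exact integral_add (p.continuous.integrable_gegenbauerMeasure hν)
      (q.continuous.integrable_gegenbauerMeasure hν)
  map_smul' c p := by
    simp only [Polynomial.eval_smul, smul_eq_mul, RingHom.id_apply]
    exact integral_const_mul _ _

lemma gegenbauerFunctional_apply {ν : ℝ} (hν : 0 < ν) (p : Polynomial ℝ) :
    gegenbauerFunctional hν p = ∫ x, p.eval x ∂(gegenbauerMeasure ν) := rfl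

lemma gegenbauerFunctional_C_mul {ν : ℝ} (hν : 0 < ν) (c : ℝ) (p : Polynomial ℝ) :
    gegenbauerFunctional hν (Polynomial.C c * p) = c * gegenbauerFunctional hν p := by
  rw [← Polynomial.smul_eq_C_mul, map_smul, smul_eq_mul]

-- Sturm-Liouville argument: integration by parts applied to the Wronskian of the two polynomials
-- leaves the difference of the eigenvalues `n (n + 2 ν)` times the integral of their product.
open Polynomial in
lemma gegenbauerPoly_orthogonal {ν : ℝ} (hν : 0 < ν) {m n : ℕ} (hmn : m ≠ n) :
    gegenbauerFunctional hν (gegenbauerPoly ν m * gegenbauerPoly ν n) = 0 := by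
  set P := gegenbauerPoly ν m
  set Q := gegenbauerPoly ν n
  have h := integral_gegenbauerMeasure_by_parts hν (derivative P * Q - P * derivative Q)
  rw [← gegenbauerFunctional_apply hν] at h
  have hP := gegenbauerPoly_ode ν m
  have hQ := gegenbauerPoly_ode ν n
  have e : (1 - X ^ 2) * derivative (derivative P * Q - P * derivative Q) -
      C (2 * ν + 1) * (X * (derivative P * Q - P * derivative Q)) =
      C (n * (n + 2 * ν) - m * (m + 2 * ν)) * (P * Q) := by
    simp only [derivative_sub, derivative_mul, C_sub]
    linear_combination Q * hP - P * hQ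
  rw [e, gegenbauerFunctional_C_mul] at h
  refine (mul_eq_zero.1 h).resolve_left ?_
  have : (n * (n + 2 * ν) - m * (m + 2 * ν) : ℝ) = (n - m) * (n + m + 2 * ν) := by ring
  rw [this]
  have h1 : (n : ℝ) - m ≠ 0 := sub_ne_zero.2 (by exact_mod_cast hmn.symm)
  have h2 : (n + m + 2 * ν : ℝ) ≠ 0 := by positivity
  exact mul_ne_zero h1 h2

/-- The squared norm of the Gegenbauer polynomial `C_n^ν`. -/
def gegenbauerNormSq {ν : ℝ} (hν : 0 < ν) (n : ℕ) : ℝ :=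
  gegenbauerFunctional hν (gegenbauerPoly ν n * gegenbauerPoly ν n)

-- The integral `I` of `x C_{n+1} C_n` is computed twice, by testing one recurrence against
-- `C_{n+1}` and the next one against `C_n`, and then eliminated.
open Polynomial in
lemma gegenbauerNormSq_succ {ν : ℝ} (hν : 0 < ν) (n : ℕ) :
    (n + 1) * (n + 1 + ν) * gegenbauerNormSq hν (n + 1) =
      (n + ν) * (n + 2 * ν) * gegenbauerNormSq hν n := by
  set I := gegenbauerFunctional hν (X * gegenbauerPoly ν (n + 1) * gegenbauerPoly ν n)
  have hA : (n + 1) * gegenbauerNormSq hν (n + 1) = 2 * (n + ν) * I := by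
    unfold gegenbauerNormSq
    -- The recurrence only produces degrees at least two, so degree one uses the explicit `C_1 = 2 ν
    -- x`.
    rcases n with _ | n
    · have e : gegenbauerPoly ν (0 + 1) * gegenbauerPoly ν (0 + 1) =
          C (2 * ν) * (X * gegenbauerPoly ν (0 + 1) * gegenbauerPoly ν 0) := by
        rw [gegenbauerPoly_zero]
        nth_rewrite 1 [zero_add, gegenbauerPoly_one]
        ring
      rw [e, gegenbauerFunctional_C_mul]
      push_cast
      ring
    · have hr := gegenbauerPoly_recurrence ν n
      have e : C ((n + 2 : ℕ) : ℝ) * (gegenbauerPoly ν (n + 2) * gegenbauerPoly ν (n + 2)) =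
          C (2 * ((n + 1 : ℕ) + ν)) * (X * gegenbauerPoly ν (n + 2) * gegenbauerPoly ν (n + 1)) -
          C (n + 2 * ν) * (gegenbauerPoly ν n * gegenbauerPoly ν (n + 2)) := by
        linear_combination gegenbauerPoly ν (n + 2) * hr
      have h := congrArg (gegenbauerFunctional hν) e
      rw [map_sub, gegenbauerFunctional_C_mul, gegenbauerFunctional_C_mul,
        gegenbauerFunctional_C_mul, gegenbauerPoly_orthogonal hν (by omega : n ≠ n + 2), mul_zero,
        sub_zero] at h
      rw [← h]
      push_cast
      ring
  have hB : 2 * (n + 1 + ν) * I = (n + 2 * ν) * gegenbauerNormSq hν n := by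
    have hr := gegenbauerPoly_recurrence ν n
    have e : C ((n + 2 : ℕ) : ℝ) * (gegenbauerPoly ν (n + 2) * gegenbauerPoly ν n) =
        C (2 * ((n + 1 : ℕ) + ν)) * (X * gegenbauerPoly ν (n + 1) * gegenbauerPoly ν n) -
        C (n + 2 * ν) * (gegenbauerPoly ν n * gegenbauerPoly ν n) := by
      linear_combination gegenbauerPoly ν n * hr
    have h := congrArg (gegenbauerFunctional hν) e
    rw [map_sub, gegenbauerFunctional_C_mul, gegenbauerFunctional_C_mul,
      gegenbauerFunctional_C_mul, gegenbauerPoly_orthogonal hν (by omega : n + 2 ≠ n),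
      mul_zero] at h
    unfold gegenbauerNormSq
    push_cast at h
    linarith
  linear_combination (n + 1 + ν) * hA + (n + ν) * hB

lemma gegenbauerNormSq_zero_pos {ν : ℝ} (hν : 0 < ν) : 0 < gegenbauerNormSq hν 0 := by
  unfold gegenbauerNormSq
  rw [gegenbauerFunctional_apply, integral_gegenbauerMeasure, gegenbauerPoly_zero]
  simp only [mul_one, Polynomial.eval_one]
  refine (setIntegral_pos_iff_support_of_nonneg_ae ?_ (integrableOn_gegenbauerWeight hν)).2 ?_
  · refine (ae_restrict_iff' measurableSet_Ioo).2 (Eventually.of_forall fun x hx => ?_)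
    exact Real.rpow_nonneg (by nlinarith [hx.1, hx.2]) _
  · have : Set.Ioo (-1 : ℝ) 1 ⊆ (Function.support fun x : ℝ => (1 - x ^ 2) ^ (ν - 1 / 2)) := by
      intro x hx
      exact (Real.rpow_pos_of_pos (by nlinarith [hx.1, hx.2]) _).ne'
    rw [Set.inter_eq_right.2 this]
    simp

lemma gegenbauerNormSq_pos {ν : ℝ} (hν : 0 < ν) (n : ℕ) : 0 < gegenbauerNormSq hν n := by
  induction n with
  | zero => exact gegenbauerNormSq_zero_pos hν
  | succ n ih =>
    have h := gegenbauerNormSq_succ hν n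
    have h1 : 0 < (n + ν) * (n + 2 * ν) * gegenbauerNormSq hν n := by positivity
    rw [← h] at h1
    exact (mul_pos_iff_of_pos_left (by positivity)).1 h1

/-- Only the dependence on `n` matters: the norm of `C_0` enters as a global constant that cancels
from the sampling formula, so it is never evaluated. -/
lemma gegenbauerNormSq_eq {ν : ℝ} (hν : 0 < ν) (n : ℕ) :
    (ν + n) * n.factorial * gegenbauerNormSq hν n =
      poch (2 * ν) n * (ν * gegenbauerNormSq hν 0) := by
  induction n with
  | zero => simp [poch_zero]
  | succ n ih =>
    have h := gegenbauerNormSq_succ hν n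
    rw [Nat.factorial_succ, poch_succ]
    push_cast
    linear_combination (n.factorial : ℝ) * h + (n + 2 * ν) * ih

/-! ### The Neumann factors -/

lemma norm_neumannFactor {ν : ℝ} (hν : 0 < ν) (n : ℕ) :
    ‖neumannFactor ν n‖ = (ν + n) * Real.sqrt (2 * (n.factorial : ℝ) / poch (2 * ν) n) := by
  unfold neumannFactor
  rw [norm_mul, norm_mul, norm_pow, Complex.norm_I, one_pow, one_mul, Complex.norm_real,
    Complex.norm_real, Real.norm_of_nonneg (by positivity), Real.norm_of_nonneg (Real.sqrt_nonneg _)]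

/-- The Neumann factor as a multiple of its absolute value, which balances the norm of
`C_n^ν`. -/
lemma neumannFactor_mul_sqrt {ν : ℝ} (hν : 0 < ν) (n : ℕ) :
    neumannFactor ν n * (Real.sqrt (gegenbauerNormSq hν n) : ℂ) =
      Complex.I ^ n * ((Real.sqrt (2 * (ν + n)) * Real.sqrt (ν * gegenbauerNormSq hν 0) : ℝ) : ℂ) := by
  have hp := poch_pos (by linarith : 0 < 2 * ν) n
  have hh := gegenbauerNormSq_pos hν n
  have h0 := gegenbauerNormSq_zero_pos hν
  have key : (ν + n) * Real.sqrt (2 * (n.factorial : ℝ) / poch (2 * ν) n) *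
      Real.sqrt (gegenbauerNormSq hν n) =
      Real.sqrt (2 * (ν + n)) * Real.sqrt (ν * gegenbauerNormSq hν 0) := by
    have hn : 0 ≤ ν + n := by positivity
    rw [← Real.sqrt_mul (by positivity), mul_assoc, ← Real.sqrt_mul (by positivity)]
    nth_rewrite 1 [← Real.sqrt_sq hn]
    rw [← Real.sqrt_mul (by positivity)]
    congr 1
    have := gegenbauerNormSq_eq hν n
    generalize poch (2 * ν) n = a at *
    field_simp
    linear_combination this
  rw [← key]
  unfold neumannFactor
  push_cast
  ring

/-- Geometric growth, however crude, is enough against the factorial decay of the Bessel functions.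
-/
lemma norm_neumannFactor_le {ν : ℝ} (hν : 0 < ν) (n : ℕ) :
    ‖neumannFactor ν n‖ ≤ 3 * (ν + 1) * (2 * (1 + 1 / (2 * ν))) ^ n := by
  have hQ : ∀ n : ℕ, (n.factorial : ℝ) / poch (2 * ν) n ≤ (1 + 1 / (2 * ν)) ^ n := by
    intro n
    induction n with
    | zero => simp [poch_zero]
    | succ n ih =>
      have h1 : 0 < poch (2 * ν) n := poch_pos (by linarith) n
      rw [poch_succ, Nat.factorial_succ, pow_succ]
      push_cast
      rw [mul_comm ((n : ℝ) + 1), mul_div_mul_comm]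
      have h2 : ((n : ℝ) + 1) / (2 * ν + n) ≤ 1 + 1 / (2 * ν) := by
        rw [div_le_iff₀ (by positivity)]
        have e : (1 + 1 / (2 * ν)) * (2 * ν + n) = 2 * ν + n + 1 + n / (2 * ν) := by
          field_simp
          ring
        rw [e]
        have : 0 ≤ (n : ℝ) / (2 * ν) := by positivity
        linarith
      gcongr
  have hn : (n : ℝ) + 1 ≤ 2 ^ n := by exact_mod_cast Nat.lt_two_pow_self
  have h1 : 0 < poch (2 * ν) n := poch_pos (by linarith) n
  have hB : 1 ≤ (1 + 1 / (2 * ν)) ^ n := one_le_pow₀ (by simp [hν.le])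
  have hs : Real.sqrt (2 * (n.factorial : ℝ) / poch (2 * ν) n) ≤ 3 * (1 + 1 / (2 * ν)) ^ n := by
    refine (Real.sqrt_le_iff.2 ⟨by positivity, ?_⟩)
    rw [mul_div_assoc]
    nlinarith [hQ n]
  rw [norm_neumannFactor hν, mul_pow]
  calc (ν + n) * Real.sqrt (2 * (n.factorial : ℝ) / poch (2 * ν) n)
      ≤ ((ν + 1) * 2 ^ n) * (3 * (1 + 1 / (2 * ν)) ^ n) := by
        gcongr
        nlinarith [(Nat.cast_nonneg n : (0 : ℝ) ≤ n)]
    _ = _ := by ring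

/-! ### Weighted shifts and Jacobi operators on `ℓ²` -/

/-- The Hilbert space of square summable complex sequences. -/
abbrev SqSeq : Type := lp (fun _ : ℕ => ℂ) 2

lemma SqSeq.sum_sq_le (v : SqSeq) (s : Finset ℕ) : ∑ i ∈ s, ‖v i‖ ^ 2 ≤ ‖v‖ ^ 2 := by
  have h := lp.sum_rpow_le_norm_rpow (p := 2) (by norm_num) v s
  simpa using h

lemma SqSeq.sum_shift_sq_le (v : SqSeq) {C : ℝ} {w : ℕ → ℂ}
    (h : ∀ n, ‖w n‖ ≤ C * ‖v (n + 1)‖) (s : Finset ℕ) :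
    ∑ i ∈ s, ‖w i‖ ^ 2 ≤ (C * ‖v‖) ^ 2 := by
  calc ∑ i ∈ s, ‖w i‖ ^ 2 ≤ ∑ i ∈ s, C ^ 2 * ‖v (i + 1)‖ ^ 2 := by
        refine Finset.sum_le_sum fun i _ => ?_
        rw [← mul_pow]
        exact pow_le_pow_left₀ (norm_nonneg _) (h i) 2
    _ = C ^ 2 * ∑ i ∈ s.map (addRightEmbedding 1), ‖v i‖ ^ 2 := by
        rw [← Finset.mul_sum, Finset.sum_map]
        rfl
    _ ≤ C ^ 2 * ‖v‖ ^ 2 := by gcongr; exact v.sum_sq_le _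
    _ = _ := by ring

lemma SqSeq.memℓp_of_shift (v : SqSeq) {C : ℝ} {w : ℕ → ℂ}
    (h : ∀ n, ‖w n‖ ≤ C * ‖v (n + 1)‖) : Memℓp w 2 :=
  memℓp_gen' (C := (C * ‖v‖) ^ 2) fun s => by simpa using v.sum_shift_sq_le h s

lemma SqSeq.norm_le_of_shift (v w : SqSeq) {C : ℝ} (hC : 0 ≤ C)
    (h : ∀ n, ‖w n‖ ≤ C * ‖v (n + 1)‖) : ‖w‖ ≤ C * ‖v‖ :=
  lp.norm_le_of_forall_sum_le (by norm_num) (by positivity)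
    fun s => by simpa using v.sum_shift_sq_le h s

lemma SqSeq.tendsto_zero (v : SqSeq) : Tendsto (fun n => v n) atTop (𝓝 0) := by
  have h := (lp.memℓp v).summable (by norm_num)
  have h2 : Tendsto (fun n => ‖v n‖ ^ 2) atTop (𝓝 0) := by simpa using h.tendsto_atTop_zero
  rw [tendsto_zero_iff_norm_tendsto_zero]
  simpa using h2.sqrt

/-- The standard unit vectors of `ℓ²`. -/
def SqSeq.basis (n : ℕ) : SqSeq := lp.single 2 n (1 : ℂ)

lemma SqSeq.basis_apply (n m : ℕ) : SqSeq.basis n m = if m = n then 1 else 0 := by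
  simp [SqSeq.basis, Pi.single_apply]

lemma SqSeq.inner_basis_left (n : ℕ) (v : SqSeq) : inner ℂ (SqSeq.basis n) v = v n := by
  rw [SqSeq.basis, lp.inner_single_left]
  simp

/-- The weighted backward shift `(v_n) ↦ (α_n v_{n + 1})` with a bounded weight. -/
def weightedShift (α : ℕ → ℝ) {C : ℝ} (hα : ∀ n, |α n| ≤ C) : SqSeq →L[ℂ] SqSeq :=
  LinearMap.mkContinuous
    { toFun := fun v => ⟨fun n => (α n : ℂ) * v (n + 1), v.memℓp_of_shift (C := C) fun n => by
        rw [norm_mul, Complex.norm_real, Real.norm_eq_abs]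
        exact mul_le_mul_of_nonneg_right (hα n) (norm_nonneg _)⟩
      map_add' := fun v w => by ext n; exact mul_add _ _ _
      map_smul' := fun c v => by ext n; exact mul_left_comm _ _ _ }
    C fun v => SqSeq.norm_le_of_shift v _ ((abs_nonneg _).trans (hα 0)) fun n => by
        change ‖(α n : ℂ) * v (n + 1)‖ ≤ _
        rw [norm_mul, Complex.norm_real, Real.norm_eq_abs]
        exact mul_le_mul_of_nonneg_right (hα n) (norm_nonneg _)

lemma weightedShift_apply (α : ℕ → ℝ) {C : ℝ} (hα : ∀ n, |α n| ≤ C) (v : SqSeq) (n : ℕ) :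
    weightedShift α hα v n = (α n : ℂ) * v (n + 1) := rfl

lemma weightedShift_basis_succ (α : ℕ → ℝ) {C : ℝ} (hα : ∀ n, |α n| ≤ C) (n : ℕ) :
    weightedShift α hα (SqSeq.basis (n + 1)) = (α n : ℂ) • SqSeq.basis n := by
  ext m
  rw [weightedShift_apply, lp.coeFn_smul, Pi.smul_apply, SqSeq.basis_apply, SqSeq.basis_apply]
  by_cases h : m = n
  · subst h; simp
  · simp [h]

lemma weightedShift_basis_zero (α : ℕ → ℝ) {C : ℝ} (hα : ∀ n, |α n| ≤ C) :
    weightedShift α hα (SqSeq.basis 0) = 0 := by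
  ext m
  simp [weightedShift_apply, SqSeq.basis_apply]

lemma adjoint_weightedShift_succ (α : ℕ → ℝ) {C : ℝ} (hα : ∀ n, |α n| ≤ C) (v : SqSeq) (n : ℕ) :
    (ContinuousLinearMap.adjoint (weightedShift α hα)) v (n + 1) = (α n : ℂ) * v n := by
  rw [← SqSeq.inner_basis_left, ContinuousLinearMap.adjoint_inner_right, weightedShift_basis_succ,
    inner_smul_left, SqSeq.inner_basis_left, Complex.conj_ofReal]

lemma adjoint_weightedShift_zero (α : ℕ → ℝ) {C : ℝ} (hα : ∀ n, |α n| ≤ C) (v : SqSeq) :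
    (ContinuousLinearMap.adjoint (weightedShift α hα)) v 0 = 0 := by
  rw [← SqSeq.inner_basis_left, ContinuousLinearMap.adjoint_inner_right, weightedShift_basis_zero,
    inner_zero_left]

/-- The finite sections of a weighted shift. -/
def truncatedShift (α : ℕ → ℝ) (N : ℕ) : SqSeq →L[ℂ] SqSeq :=
  ∑ i ∈ Finset.range N,
    (α i : ℂ) • InnerProductSpace.rankOne ℂ (SqSeq.basis i) (SqSeq.basis (i + 1))

lemma truncatedShift_apply (α : ℕ → ℝ) (N : ℕ) (v : SqSeq) (n : ℕ) :
    truncatedShift α N v n = if n < N then (α n : ℂ) * v (n + 1) else 0 := by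
  induction N with
  | zero => simp [truncatedShift]
  | succ N ih =>
    have e : truncatedShift α (N + 1) v = truncatedShift α N v +
        ((α N : ℂ) * v (N + 1)) • SqSeq.basis N := by
      unfold truncatedShift
      rw [Finset.sum_range_succ, add_apply, smul_apply,
        InnerProductSpace.rankOne_apply, SqSeq.inner_basis_left, smul_smul]
    rw [e, lp.coeFn_add, Pi.add_apply, ih, lp.coeFn_smul, Pi.smul_apply, SqSeq.basis_apply]
    rcases lt_trichotomy n N with h | rfl | h
    · simp [h, h.ne, h.trans (Nat.lt_succ_self N)]
    · simp
    · simp [h.ne', not_lt.2 h.le, not_lt.2 (Nat.succ_le_of_lt h)]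

/-- The difference is a weighted shift with only the weights of index at least `N`, so its norm is
bounded by their supremum. Compactness of the shift follows by finite rank approximation, and that
of its adjoint because taking adjoints is continuous. -/
lemma tendsto_truncatedShift (α : ℕ → ℝ) {C : ℝ} (hα : ∀ n, |α n| ≤ C)
    (h0 : Tendsto α atTop (𝓝 0)) :
    Tendsto (truncatedShift α) atTop (𝓝 (weightedShift α hα)) := by
  rw [Metric.tendsto_atTop]
  intro ε hε
  obtain ⟨N₀, hN₀⟩ := Metric.tendsto_atTop.1 h0 (ε / 2) (by positivity)
  refine ⟨N₀, fun N hN => ?_⟩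
  rw [dist_eq_norm]
  refine lt_of_le_of_lt (ContinuousLinearMap.opNorm_le_bound _ (by positivity : 0 ≤ ε / 2)
    fun v => SqSeq.norm_le_of_shift v _ (by positivity) fun n => ?_) (by linarith)
  rw [sub_apply, lp.coeFn_sub, Pi.sub_apply, truncatedShift_apply,
    weightedShift_apply]
  split_ifs with h
  · rw [sub_self, norm_zero]
    positivity
  · rw [zero_sub, norm_neg, norm_mul, Complex.norm_real]
    have := hN₀ n (by omega)
    rw [dist_zero_right] at this
    gcongr

lemma isCompactOperator_rankOne {E : Type*} [NormedAddCommGroup E] [InnerProductSpace ℂ E]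
    (x y : E) : IsCompactOperator (InnerProductSpace.rankOne ℂ x y) := by
  rw [InnerProductSpace.rankOne_def']
  exact (isCompactOperator_of_locallyCompactSpace_rng
    (ContinuousLinearMap.toSpanSingleton ℂ x)).comp_clm (innerSL ℂ y)

lemma isCompactOperator_sum_rankOne {E : Type*} [NormedAddCommGroup E] [InnerProductSpace ℂ E]
    (c : ℕ → ℂ) (x y : ℕ → E) (N : ℕ) :
    IsCompactOperator ⇑(∑ i ∈ Finset.range N,
      c i • InnerProductSpace.rankOne ℂ (x i) (y i) : E →L[ℂ] E) := by
  induction N with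
  | zero => simpa using isCompactOperator_zero
  | succ N ih =>
    rw [Finset.sum_range_succ]
    exact ih.add ((isCompactOperator_rankOne (x N) (y N)).smul (c N))

lemma isCompactOperator_weightedShift (α : ℕ → ℝ) {C : ℝ} (hα : ∀ n, |α n| ≤ C)
    (h0 : Tendsto α atTop (𝓝 0)) : IsCompactOperator (weightedShift α hα) :=
  isCompactOperator_of_tendsto (tendsto_truncatedShift α hα h0)
    (Eventually.of_forall fun N => isCompactOperator_sum_rankOne _ _ _ N)

lemma isCompactOperator_adjoint_weightedShift (α : ℕ → ℝ) {C : ℝ} (hα : ∀ n, |α n| ≤ C)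
    (h0 : Tendsto α atTop (𝓝 0)) :
    IsCompactOperator (ContinuousLinearMap.adjoint (weightedShift α hα)) := by
  have hc : Continuous fun T : SqSeq →L[ℂ] SqSeq => ContinuousLinearMap.adjoint T :=
    ContinuousLinearMap.adjoint.continuous
  refine isCompactOperator_of_tendsto ((hc.tendsto _).comp (tendsto_truncatedShift α hα h0))
    (Eventually.of_forall fun N => ?_)
  have : ContinuousLinearMap.adjoint (truncatedShift α N) = ∑ i ∈ Finset.range N,
      (α i : ℂ) • InnerProductSpace.rankOne ℂ (SqSeq.basis (i + 1)) (SqSeq.basis i) := by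
    unfold truncatedShift
    rw [map_sum]
    refine Finset.sum_congr rfl fun i _ => ?_
    rw [map_smulₛₗ, InnerProductSpace.adjoint_rankOne, Complex.conj_ofReal]
  simp only [Function.comp_apply]
  rw [this]
  exact isCompactOperator_sum_rankOne _ _ _ N

/-- The Jacobi operator with zero diagonal and off-diagonal entries `α`. -/
def jacobiOperator (α : ℕ → ℝ) {C : ℝ} (hα : ∀ n, |α n| ≤ C) : SqSeq →L[ℂ] SqSeq :=
  weightedShift α hα + ContinuousLinearMap.adjoint (weightedShift α hα)

lemma jacobiOperator_zero (α : ℕ → ℝ) {C : ℝ} (hα : ∀ n, |α n| ≤ C) (v : SqSeq) :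
    jacobiOperator α hα v 0 = (α 0 : ℂ) * v 1 := by
  rw [jacobiOperator, add_apply, lp.coeFn_add, Pi.add_apply,
    adjoint_weightedShift_zero, weightedShift_apply, add_zero]

lemma jacobiOperator_succ (α : ℕ → ℝ) {C : ℝ} (hα : ∀ n, |α n| ≤ C) (v : SqSeq) (n : ℕ) :
    jacobiOperator α hα v (n + 1) = (α (n + 1) : ℂ) * v (n + 2) + (α n : ℂ) * v n := by
  rw [jacobiOperator, add_apply, lp.coeFn_add, Pi.add_apply,
    adjoint_weightedShift_succ, weightedShift_apply]

lemma isCompactOperator_jacobiOperator (α : ℕ → ℝ) {C : ℝ} (hα : ∀ n, |α n| ≤ C)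
    (h0 : Tendsto α atTop (𝓝 0)) : IsCompactOperator (jacobiOperator α hα) :=
  (isCompactOperator_weightedShift α hα h0).add (isCompactOperator_adjoint_weightedShift α hα h0)

lemma isSymmetric_jacobiOperator (α : ℕ → ℝ) {C : ℝ} (hα : ∀ n, |α n| ≤ C) :
    (jacobiOperator α hα : SqSeq →ₗ[ℂ] SqSeq).IsSymmetric := by
  intro v w
  simp only [jacobiOperator, ContinuousLinearMap.coe_coe, add_apply,
    inner_add_left, inner_add_right, ContinuousLinearMap.adjoint_inner_left,
    ContinuousLinearMap.adjoint_inner_right]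
  ring

/-! ### The Jacobi operator of the Bessel functions and its eigenvectors -/

/-- The weight `√(2 (ν + n))` which makes the recurrence of the Bessel functions symmetric. -/
def besselWeight (ν : ℝ) (n : ℕ) : ℝ := Real.sqrt (2 * (ν + n))

lemma besselWeight_pos {ν : ℝ} (hν : 0 < ν) (n : ℕ) : 0 < besselWeight ν n :=
  Real.sqrt_pos.2 (by positivity)

lemma besselWeight_sq {ν : ℝ} (hν : 0 < ν) (n : ℕ) : besselWeight ν n ^ 2 = 2 * (ν + n) :=
  Real.sq_sqrt (by positivity)

lemma besselWeight_le {ν : ℝ} (hν : 0 < ν) (n : ℕ) : besselWeight ν n ≤ 2 * (ν + 1) * 2 ^ n := by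
  have hn : (n : ℝ) + 1 ≤ 2 ^ n := by exact_mod_cast Nat.lt_two_pow_self
  have h1 : (1 : ℝ) ≤ 2 ^ n := one_le_pow₀ (by norm_num)
  have h := besselWeight_sq hν n
  nlinarith [besselWeight_pos hν n, sq_nonneg (besselWeight ν n - 1)]

/-- The off-diagonal entries of the Jacobi matrix attached to the Bessel functions `J_{ν + n}`,
`n ≥ 1`; the entry at `0` vanishes. -/
def besselOffDiag (ν : ℝ) (n : ℕ) : ℝ :=
  if n = 0 then 0 else (besselWeight ν n * besselWeight ν (n + 1))⁻¹

lemma abs_besselOffDiag_le {ν : ℝ} (hν : 0 < ν) (n : ℕ) : |besselOffDiag ν n| ≤ 1 / n := by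
  unfold besselOffDiag
  split_ifs with h
  · simp
  · have h0 := besselWeight_pos hν n
    have h1 := besselWeight_pos hν (n + 1)
    have hn : (0 : ℝ) < n := by exact_mod_cast Nat.pos_of_ne_zero h
    rw [abs_of_pos (by positivity), ← one_div]
    have hle : besselWeight ν n ≤ besselWeight ν (n + 1) := by
      unfold besselWeight
      push_cast
      exact Real.sqrt_le_sqrt (by linarith)
    have := besselWeight_sq hν n
    gcongr
    nlinarith

lemma abs_besselOffDiag_le_one {ν : ℝ} (hν : 0 < ν) (n : ℕ) : |besselOffDiag ν n| ≤ 1 := by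
  refine (abs_besselOffDiag_le hν n).trans ?_
  rcases n with _ | n
  · simp
  · rw [div_le_one (by positivity)]
    push_cast
    linarith [(Nat.cast_nonneg n : (0 : ℝ) ≤ n)]

lemma tendsto_besselOffDiag {ν : ℝ} (hν : 0 < ν) :
    Tendsto (besselOffDiag ν) atTop (𝓝 0) :=
  squeeze_zero_norm (abs_besselOffDiag_le hν) tendsto_one_div_atTop_nhds_zero_nat

/-- The compact self-adjoint operator that is diagonalized by the zeros of `J_ν`. -/
def besselOperator {ν : ℝ} (hν : 0 < ν) : SqSeq →L[ℂ] SqSeq :=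
  jacobiOperator (besselOffDiag ν) (abs_besselOffDiag_le_one hν)

/-- A majorant of `√(2 (ν + n)) |besselSeq ν n t|` on `|t| ≤ R`. -/
def besselMajorant (ν R : ℝ) (n : ℕ) : ℝ :=
  (2 * (ν + 1) * ((Real.Gamma (ν + 1))⁻¹ * Real.exp ((R / 2) ^ 2))) * R ^ n / n.factorial

lemma abs_weight_mul_besselSeq_le {ν : ℝ} (hν : 0 < ν) (n : ℕ) {t R : ℝ} (ht : |t| ≤ R) :
    |besselWeight ν n * besselSeq ν n t| ≤ besselMajorant ν R n := by
  have hG : 0 < Real.Gamma (ν + 1) := Real.Gamma_pos_of_pos (by positivity)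
  have hR : 0 ≤ R := (abs_nonneg t).trans ht
  rw [abs_mul, abs_of_pos (besselWeight_pos hν n)]
  calc besselWeight ν n * |besselSeq ν n t| ≤ (2 * (ν + 1) * 2 ^ n) *
        ((Real.Gamma (ν + 1))⁻¹ * Real.exp ((R / 2) ^ 2) * (R / 2) ^ n / n.factorial) := by
        gcongr
        · exact besselWeight_le hν n
        · exact abs_besselSeq_le_of_abs_le hν n ht
    _ = besselMajorant ν R n := by
        unfold besselMajorant
        have : R ^ n = 2 ^ n * (R / 2) ^ n := by rw [← mul_pow, mul_div_cancel₀ R two_ne_zero]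
        rw [this]
        ring

lemma summable_besselMajorant_sq (ν R : ℝ) : Summable fun n => besselMajorant ν R n ^ 2 := by
  set D := 2 * (ν + 1) * ((Real.Gamma (ν + 1))⁻¹ * Real.exp ((R / 2) ^ 2)) with hD
  refine Summable.of_nonneg_of_le (fun n => sq_nonneg _) (fun n => ?_)
    (summable_exp_term (D ^ 2) (R ^ 2))
  have h1 : (1 : ℝ) ≤ n.factorial := by exact_mod_cast Nat.factorial_pos n
  unfold besselMajorant
  rw [← hD, div_pow, mul_pow, ← pow_mul, ← pow_mul, mul_comm n 2]
  have : 0 ≤ D ^ 2 * R ^ (2 * n) := by rw [pow_mul]; positivity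
  gcongr
  nlinarith

lemma summable_weight_mul_besselSeq_sq {ν : ℝ} (hν : 0 < ν) (t : ℝ) :
    Summable fun n => (besselWeight ν n * besselSeq ν n t) ^ 2 := by
  refine Summable.of_nonneg_of_le (fun n => sq_nonneg _) (fun n => ?_)
    (summable_besselMajorant_sq ν |t|)
  rw [← sq_abs]
  exact pow_le_pow_left₀ (abs_nonneg _) (abs_weight_mul_besselSeq_le hν n le_rfl) 2

/-- The vector `(√(2 (ν + n)) besselSeq ν n t)_n` of `ℓ²`. -/
def besselVec {ν : ℝ} (hν : 0 < ν) (t : ℝ) : SqSeq :=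
  ⟨fun n => ((besselWeight ν n * besselSeq ν n t : ℝ) : ℂ), memℓp_gen (by
    simpa [mul_pow] using summable_weight_mul_besselSeq_sq hν t)⟩

lemma besselVec_apply {ν : ℝ} (hν : 0 < ν) (t : ℝ) (n : ℕ) :
    besselVec hν t n = ((besselWeight ν n * besselSeq ν n t : ℝ) : ℂ) := rfl

lemma SqSeq.norm_sq_eq_tsum (v : SqSeq) : ‖v‖ ^ 2 = ∑' n, ‖v n‖ ^ 2 := by
  have h := lp.norm_rpow_eq_tsum (p := 2) (by norm_num) v
  simpa using h

/-- Coordinatewise continuity with a square summable majorant that is locally uniform in `t`.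
Continuity at the origin yields the limit term of the sampling series. -/
lemma continuous_besselVec {ν : ℝ} (hν : 0 < ν) : Continuous (besselVec hν) := by
  refine continuous_iff_continuousAt.2 fun t => ?_
  rw [ContinuousAt, tendsto_iff_norm_sub_tendsto_zero]
  have key : Tendsto (fun s => ‖besselVec hν s - besselVec hν t‖ ^ 2) (𝓝 t) (𝓝 0) := by
    simp only [SqSeq.norm_sq_eq_tsum]
    have hz : (0 : ℝ) = ∑' n : ℕ, (0 : ℝ) := by simp
    rw [hz]
    refine tendsto_tsum_of_dominated_convergence (bound := fun n =>
      4 * besselMajorant ν (|t| + 1) n ^ 2) ((summable_besselMajorant_sq _ _).mul_left 4)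
      (fun n => ?_) ?_
    · have hc := continuous_besselSeq hν n
      have : Continuous fun s => ‖(besselVec hν s - besselVec hν t) n‖ ^ 2 := by
        simp only [lp.coeFn_sub, Pi.sub_apply, besselVec_apply]
        fun_prop
      simpa using this.tendsto t
    · have hev : ∀ᶠ s in 𝓝 t, |s| < |t| + 1 :=
        continuous_abs.continuousAt.eventually_lt continuousAt_const (by linarith)
      filter_upwards [hev] with s hs n
      rw [lp.coeFn_sub, Pi.sub_apply, besselVec_apply, besselVec_apply, norm_pow, norm_norm,
        ← Complex.ofReal_sub, Complex.norm_real]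
      have h1 := abs_weight_mul_besselSeq_le hν n hs.le
      have h2 := abs_weight_mul_besselSeq_le hν n (by linarith : |t| ≤ |t| + 1)
      have h3 := (norm_sub_le (besselWeight ν n * besselSeq ν n s)
        (besselWeight ν n * besselSeq ν n t)).trans (add_le_add h1 h2)
      calc _ ≤ (besselMajorant ν (|t| + 1) n + besselMajorant ν (|t| + 1) n) ^ 2 :=
            pow_le_pow_left₀ (norm_nonneg _) h3 2
        _ = _ := by ring
  simpa using key.sqrt

lemma besselVec_ne_zero {ν : ℝ} (hν : 0 < ν) (t : ℝ) : besselVec hν t ≠ 0 := by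
  intro h
  have h' : ∀ n, besselSeq ν n t = 0 := by
    intro n
    have h1 : besselVec hν t n = 0 := by rw [h]; rfl
    rw [besselVec_apply, Complex.ofReal_eq_zero] at h1
    exact (mul_eq_zero.1 h1).resolve_left (besselWeight_pos hν n).ne'
  rcases eq_or_ne t 0 with rfl | ht
  · have := h' 0
    rw [besselSeq_at_zero, if_pos rfl] at this
    exact (inv_pos.2 (Real.Gamma_pos_of_pos (by positivity : 0 < ν + 1))).ne' this
  · exact besselSeq_pair_ne_zero hν ht 0 (h' 0) (h' 1)

lemma besselOperator_apply_zero {ν : ℝ} (hν : 0 < ν) (v : SqSeq) : besselOperator hν v 0 = 0 := by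
  rw [besselOperator, jacobiOperator_zero]
  simp [besselOffDiag]

/-- The action of the operator in the normalization `w_n = v_n / √(2 (ν + n))`, with `w_0`
replaced by `0`. -/
lemma besselOperator_apply_succ {ν : ℝ} (hν : 0 < ν) (v : SqSeq) {w : ℕ → ℂ} (hw0 : w 0 = 0)
    (hw : ∀ n, v (n + 1) = (besselWeight ν (n + 1) : ℂ) * w (n + 1)) (n : ℕ) :
    (besselWeight ν (n + 1) : ℂ) * besselOperator hν v (n + 1) = w n + w (n + 2) := by
  have hne : ∀ n, (besselWeight ν n : ℂ) ≠ 0 := fun n => by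
    exact_mod_cast (besselWeight_pos hν n).ne'
  have h1 := hne (n + 1)
  have h2 := hne (n + 2)
  rw [besselOperator, jacobiOperator_succ, hw (n + 1)]
  rcases n with _ | n
  · rw [hw0]
    simp only [besselOffDiag, if_true, zero_add, one_ne_zero, if_false]
    push_cast
    simp only [zero_add] at h1 h2
    field_simp
    ring
  · rw [hw n]
    have h3 := hne (n + 1)
    simp only [besselOffDiag, Nat.succ_ne_zero, if_false]
    push_cast
    field_simp
    ring

/-- The vectors `besselVec τ` for the zeros `τ` of `J_ν` are eigenvectors. -/
lemma besselOperator_besselVec {ν : ℝ} (hν : 0 < ν) {τ : ℝ} (hτ : τ ∈ besselZeros ν) :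
    besselOperator hν (besselVec hν τ) = ((τ⁻¹ : ℝ) : ℂ) • besselVec hν τ := by
  have hw : ∀ n, besselVec hν τ (n + 1) = (besselWeight ν (n + 1) : ℂ) *
      (if n + 1 = 0 then 0 else ((besselSeq ν (n + 1) τ : ℝ) : ℂ)) := by
    intro n
    rw [besselVec_apply, if_neg n.succ_ne_zero, Complex.ofReal_mul]
  ext n
  rw [lp.coeFn_smul, Pi.smul_apply, smul_eq_mul]
  rcases n with _ | n
  · rw [besselOperator_apply_zero, besselVec_apply]
    -- Row `0` of the matrix is zero: either the eigenvalue vanishes, by the convention `0⁻¹ = 0`,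
    -- or the coordinate `0` of the vector does.
    rcases (mem_besselZeros_iff hν τ).1 hτ with h | h
    · simp [h]
    · simp [h]
  · have hne : (besselWeight ν (n + 1) : ℂ) ≠ 0 := by
      exact_mod_cast (besselWeight_pos hν (n + 1)).ne'
    have h := besselOperator_apply_succ hν (besselVec hν τ)
      (w := fun n => if n = 0 then 0 else ((besselSeq ν n τ : ℝ) : ℂ)) (by simp) hw n
    apply mul_left_cancel₀ hne
    rw [h, besselVec_apply]
    rcases eq_or_ne τ 0 with rfl | h0
    · rcases eq_or_ne n 0 with rfl | hn <;> simp [besselSeq_at_zero, *]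
    · have hz := ((mem_besselZeros_iff hν τ).1 hτ).resolve_left h0
      -- Deleting the coupling to coordinate `0` changes nothing, as this coordinate is zero at `τ`.
      have e : (if n = 0 then 0 else ((besselSeq ν n τ : ℝ) : ℂ)) = ((besselSeq ν n τ : ℝ) : ℂ) := by
        split_ifs with hn
        · rw [hn, hz, Complex.ofReal_zero]
        · rfl
      simp only [e, Nat.add_eq_zero_iff, OfNat.ofNat_ne_zero, and_false, if_false]
      have hr := besselSeq_recurrence hν n τ
      rw [← besselWeight_sq hν] at hr
      norm_cast
      field_simp
      linarith

lemma isSymmetric_besselOperator {ν : ℝ} (hν : 0 < ν) :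
    (besselOperator hν : SqSeq →ₗ[ℂ] SqSeq).IsSymmetric :=
  isSymmetric_jacobiOperator _ _

/-- Eigenvectors of a symmetric operator for different real eigenvalues. Inversion with `0⁻¹ = 0` is
injective, so the origin needs no separate case. -/
lemma besselVec_orthogonal {ν : ℝ} (hν : 0 < ν) {σ τ : ℝ} (hσ : σ ∈ besselZeros ν)
    (hτ : τ ∈ besselZeros ν) (hne : σ ≠ τ) :
    inner ℂ (besselVec hν σ) (besselVec hν τ) = 0 := by
  have h := isSymmetric_besselOperator hν (besselVec hν σ) (besselVec hν τ)
  simp only [ContinuousLinearMap.coe_coe, besselOperator_besselVec hν hσ,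
    besselOperator_besselVec hν hτ, inner_smul_left, inner_smul_right, Complex.conj_ofReal] at h
  rw [← sub_eq_zero, ← sub_mul] at h
  refine (mul_eq_zero.1 h).resolve_left ?_
  rw [← Complex.ofReal_sub, Complex.ofReal_eq_zero, sub_eq_zero]
  exact fun e => hne (inv_injective e)

/-! ### Completeness of the eigenvectors -/

/-- A solution of `w_n + w_{n + 2} = 0` that tends to `0` vanishes. -/
lemma eq_zero_of_alternating {w : ℕ → ℂ} (h : ∀ n, w n + w (n + 2) = 0)
    (h0 : Tendsto w atTop (𝓝 0)) (n : ℕ) : w n = 0 := by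
  have hk : ∀ k, ‖w (n + 2 * k)‖ = ‖w n‖ := by
    intro k
    induction k with
    | zero => simp
    | succ k ih =>
      rw [← ih, show n + 2 * (k + 1) = n + 2 * k + 2 by ring,
        eq_neg_of_add_eq_zero_right (h (n + 2 * k)), norm_neg]
  have ht : Tendsto (fun k : ℕ => n + 2 * k) atTop atTop :=
    tendsto_atTop_mono (fun k => by simp only [id]; omega) tendsto_id
  have h1 := (h0.comp ht).norm
  simp only [Function.comp_def, hk, norm_zero] at h1
  exact norm_eq_zero.1 (tendsto_nhds_unique tendsto_const_nhds h1)

lemma tendsto_besselSeq {ν : ℝ} (hν : 0 < ν) (t : ℝ) :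
    Tendsto (fun n => ((besselSeq ν n t : ℝ) : ℂ)) atTop (𝓝 0) := by
  have h := (summable_geometric_mul_besselSeq hν 1 t zero_le_one).tendsto_atTop_zero
  rw [tendsto_zero_iff_norm_tendsto_zero]
  simpa using h

/-- A null solution of the Bessel recurrence with `w_0 = 0` is a multiple of the minimal solution
`besselSeq`, and `t` is a zero of `J_ν` unless it vanishes identically. -/
lemma besselRecurrence_minimal {ν : ℝ} (hν : 0 < ν) {t : ℝ} (ht : t ≠ 0) {w : ℕ → ℂ}
    (h : ∀ n, (t : ℂ) * (w n + w (n + 2)) = 2 * (ν + (n + 1 : ℕ)) * w (n + 1)) (hw0 : w 0 = 0)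
    (hlim : Tendsto w atTop (𝓝 0)) :
    (∀ n, w n = 0) ∨ (besselSeq ν 0 t = 0 ∧ ∃ κ : ℂ, ∀ n, w n = κ * (besselSeq ν n t : ℝ)) := by
  have htc : (t : ℂ) ≠ 0 := by exact_mod_cast ht
  have hy : ∀ n, (t : ℂ) * (((besselSeq ν n t : ℝ) : ℂ) + ((besselSeq ν (n + 2) t : ℝ) : ℂ)) =
      2 * (ν + (n + 1 : ℕ)) * ((besselSeq ν (n + 1) t : ℝ) : ℂ) := by
    intro n
    exact_mod_cast besselSeq_recurrence hν n t
  generalize hY : (fun n => ((besselSeq ν n t : ℝ) : ℂ)) = y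
  have hYn : ∀ n, ((besselSeq ν n t : ℝ) : ℂ) = y n := fun n => congrFun hY n
  simp only [hYn] at hy ⊢
  -- The Casoratian of two solutions is constant. Both solutions tend to `0`, so it vanishes, and `w
  -- 0 = 0` reduces this to `w 1 * y 0 = 0`.
  have hcas : ∀ n, w n * y (n + 1) - w (n + 1) * y n = w 0 * y 1 - w 1 * y 0 := by
    intro n
    induction n with
    | zero => rfl
    | succ n ih =>
      rw [← ih]
      apply mul_left_cancel₀ htc
      linear_combination w (n + 1) * hy n - y (n + 1) * h n
  have hylim : Tendsto y atTop (𝓝 0) := hY ▸ tendsto_besselSeq hν t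
  have hclim : Tendsto (fun n => w n * y (n + 1) - w (n + 1) * y n) atTop (𝓝 0) := by
    simpa using (hlim.mul (hylim.comp (tendsto_add_atTop_nat 1))).sub
      ((hlim.comp (tendsto_add_atTop_nat 1)).mul hylim)
  simp only [hcas] at hclim
  have hc : w 0 * y 1 - w 1 * y 0 = 0 := tendsto_nhds_unique tendsto_const_nhds hclim
  rw [hw0, zero_mul, zero_sub, neg_eq_zero] at hc
  have hstep : ∀ κ : ℂ, w 0 = κ * y 0 → w 1 = κ * y 1 → ∀ n, w n = κ * y n := by
    intro κ h0 h1 n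
    induction n using Nat.twoStepInduction with
    | zero => exact h0
    | one => exact h1
    | more n ih1 ih2 =>
      apply mul_left_cancel₀ htc
      linear_combination h n - κ * hy n - t * ih1 + 2 * (ν + (n + 1 : ℕ)) * ih2
  rcases mul_eq_zero.1 hc with h1 | h1
  · left
    intro n
    simpa using hstep 0 (by simpa using hw0) (by simpa using h1) n
  · right
    have hy0 : besselSeq ν 0 t = 0 := by
      have := (hYn 0).trans h1
      exact_mod_cast this
    refine ⟨hy0, w 1 / y 1, hstep _ (by rw [hw0, h1, mul_zero]) ?_⟩
    have : y 1 ≠ 0 := by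
      rw [← hYn 1]
      exact_mod_cast besselSeq_pair_ne_zero hν ht 0 hy0
    field_simp

/-- Divided by the weights, an eigenvector solves the Bessel recurrence at `t = 1 / l` with `w_0 =
0` and tends to `0`; being minimal, it is a multiple of `V(1 / l)`, and it can be nonzero only if `1
/ l` is a zero of `J_ν`. For `l = 0` only multiples of `e_0`, that is of `V(0)`, remain. -/
lemma mem_span_of_besselOperator_eq {ν : ℝ} (hν : 0 < ν) {l : ℝ} {v : SqSeq}
    (h : besselOperator hν v = (l : ℂ) • v) :
    v ∈ Submodule.span ℂ (Set.range fun τ : besselZeros ν => besselVec hν τ) := by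
  have hne : ∀ n, (besselWeight ν n : ℂ) ≠ 0 := fun n => by
    exact_mod_cast (besselWeight_pos hν n).ne'
  set w : ℕ → ℂ := fun n => if n = 0 then 0 else v n / besselWeight ν n with hwdef
  have hw0 : w 0 = 0 := by simp [hwdef]
  have hw : ∀ n, v (n + 1) = (besselWeight ν (n + 1) : ℂ) * w (n + 1) := by
    intro n
    have := hne (n + 1)
    simp only [hwdef, Nat.succ_ne_zero, if_false]
    field_simp
  have hwlim : Tendsto w atTop (𝓝 0) := by
    have hv := v.tendsto_zero
    refine squeeze_zero_norm (a := fun n => ‖v n‖ * (Real.sqrt (2 * ν))⁻¹) (fun n => ?_)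
      (by simpa using hv.norm.mul_const (Real.sqrt (2 * ν))⁻¹)
    have hs : 0 < Real.sqrt (2 * ν) := Real.sqrt_pos.2 (by positivity)
    simp only [hwdef]
    split_ifs with hn
    · rw [norm_zero]
      positivity
    · rw [norm_div, Complex.norm_real, Real.norm_of_nonneg (besselWeight_pos hν n).le,
        ← div_eq_mul_inv]
      gcongr
      unfold besselWeight
      exact Real.sqrt_le_sqrt (by linarith [(Nat.cast_nonneg n : (0 : ℝ) ≤ n)])
  have hrec : ∀ n, w n + w (n + 2) = (l : ℂ) * (2 * (ν + (n + 1 : ℕ))) * w (n + 1) := by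
    intro n
    have hr := besselOperator_apply_succ hν v hw0 hw n
    rw [h, lp.coeFn_smul, Pi.smul_apply, smul_eq_mul, hw n] at hr
    have hsq : (besselWeight ν (n + 1) : ℂ) ^ 2 = 2 * (ν + (n + 1 : ℕ)) := by
      exact_mod_cast besselWeight_sq hν (n + 1)
    rw [← hr, ← hsq]
    ring
  have hmem : ∀ τ ∈ besselZeros ν, besselVec hν τ ∈
      Submodule.span ℂ (Set.range fun τ : besselZeros ν => besselVec hν τ) :=
    fun τ hτ => Submodule.subset_span ⟨⟨τ, hτ⟩, rfl⟩
  have hzero : (0 : ℝ) ∈ besselZeros ν := (mem_besselZeros_iff hν 0).2 (Or.inl rfl)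
  rcases eq_or_ne l 0 with rfl | hl
  · have hw' : ∀ n, w n = 0 := eq_zero_of_alternating (fun n => by rw [hrec n]; simp) hwlim
    have hG : Real.Gamma (ν + 1) ≠ 0 := (Real.Gamma_pos_of_pos (by positivity)).ne'
    have : v = (v 0 / besselVec hν 0 0) • besselVec hν 0 := by
      ext n
      rw [lp.coeFn_smul, Pi.smul_apply, smul_eq_mul]
      rcases n with _ | n
      · have : besselVec hν 0 0 ≠ 0 := by
          rw [besselVec_apply, besselSeq_at_zero, if_pos rfl, Complex.ofReal_ne_zero]
          exact mul_ne_zero (besselWeight_pos hν 0).ne' (inv_ne_zero hG)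
        field_simp
      · rw [hw, hw', besselVec_apply hν 0 (n + 1), besselSeq_at_zero]
        simp
    rw [this]
    exact Submodule.smul_mem _ _ (hmem 0 hzero)
  · have hlc : (l : ℂ) ≠ 0 := by exact_mod_cast hl
    have hv0 : v 0 = 0 := by
      have h0 := besselOperator_apply_zero hν v
      rw [h, lp.coeFn_smul, Pi.smul_apply, smul_eq_mul] at h0
      exact (mul_eq_zero.1 h0).resolve_left hlc
    have hwv : ∀ n, v n = (besselWeight ν n : ℂ) * w n := by
      rintro (_ | n)
      · rw [hv0, hw0, mul_zero]
      · exact hw n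
    rcases besselRecurrence_minimal hν (inv_ne_zero hl) (w := w) (fun n => by
      rw [hrec n]
      push_cast
      field_simp) hw0 hwlim with hw' | ⟨hz, κ, hκ⟩
    · have : v = 0 := by
        ext n
        rw [hwv, hw', mul_zero]
        rfl
      rw [this]
      exact Submodule.zero_mem _
    · have : v = κ • besselVec hν l⁻¹ := by
        ext n
        rw [hwv, hκ, lp.coeFn_smul, Pi.smul_apply, smul_eq_mul, besselVec_apply, Complex.ofReal_mul]
        ring
      rw [this]
      exact Submodule.smul_mem _ _ (hmem _ ((mem_besselZeros_iff hν _).2 (Or.inr hz)))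

/-- Spectral theorem for compact self-adjoint operators: the eigenspaces have trivial joint
orthogonal complement, and each lies in the span because its eigenvalue is real. -/
lemma orthogonal_span_besselVec {ν : ℝ} (hν : 0 < ν) :
    (Submodule.span ℂ (Set.range fun τ : besselZeros ν => besselVec hν τ))ᗮ = ⊥ := by
  have hs := isSymmetric_besselOperator hν
  have hspec := ContinuousLinearMap.orthogonalComplement_iSup_eigenspaces_eq_bot
    (isCompactOperator_jacobiOperator (besselOffDiag ν) (abs_besselOffDiag_le_one hν)
      (tendsto_besselOffDiag hν)) hs
  rw [eq_bot_iff, ← hspec]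
  refine Submodule.orthogonal_le (iSup_le fun l v hv => ?_)
  rcases eq_or_ne v 0 with rfl | hv0
  · exact Submodule.zero_mem _
  · have hl := hs.conj_eigenvalue_eq_self
      (Module.End.hasEigenvalue_of_hasEigenvector (μ := l) (x := v) ⟨hv, hv0⟩)
    obtain ⟨r, rfl⟩ := Complex.conj_eq_iff_real.1 hl
    exact mem_span_of_besselOperator_eq hν (Module.End.mem_eigenspace_iff.1 hv)

/-- Expansion of an element of `ℓ²` along the orthogonal basis indexed by the zeros of `J_ν`. -/
lemma hasSum_besselVec {ν : ℝ} (hν : 0 < ν) (β : SqSeq) :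
    HasSum (fun τ : besselZeros ν => (inner ℂ (besselVec hν τ) β / (‖besselVec hν τ‖ ^ 2 : ℝ)) •
      besselVec hν τ) β := by
  set e : besselZeros ν → SqSeq := fun τ => ((‖besselVec hν τ‖⁻¹ : ℝ) : ℂ) • besselVec hν τ with he
  have hn : ∀ τ : besselZeros ν, ‖besselVec hν τ‖ ≠ 0 :=
    fun τ => norm_ne_zero_iff.2 (besselVec_ne_zero hν τ)
  have hon : Orthonormal ℂ e := by
    refine ⟨fun τ => ?_, fun σ τ hne => ?_⟩
    · rw [he, norm_smul, Complex.norm_real, norm_inv, norm_norm, inv_mul_cancel₀ (hn τ)]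
    · change inner ℂ (e σ) (e τ) = 0
      rw [he, inner_smul_left, inner_smul_right,
        besselVec_orthogonal hν σ.2 τ.2 (fun h => hne (Subtype.ext h)), mul_zero, mul_zero]
  have hspan : (Submodule.span ℂ (Set.range e))ᗮ = ⊥ := by
    rw [eq_bot_iff, ← orthogonal_span_besselVec hν]
    refine Submodule.orthogonal_le (Submodule.span_le.2 ?_)
    rintro _ ⟨τ, rfl⟩
    have : besselVec hν τ = ((‖besselVec hν τ‖ : ℝ) : ℂ) • e τ := by
      rw [he, smul_smul, ← Complex.ofReal_mul, mul_inv_cancel₀ (hn τ), Complex.ofReal_one, one_smul]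
    change besselVec hν τ ∈ _
    rw [this]
    exact Submodule.smul_mem _ _ (Submodule.subset_span ⟨τ, rfl⟩)
  have h := (HilbertBasis.mkOfOrthogonalEqBot hon hspan).hasSum_repr β
  convert h using 2 with τ
  rw [HilbertBasis.repr_apply_apply, HilbertBasis.coe_mkOfOrthogonalEqBot, he, inner_smul_left,
    smul_smul, Complex.conj_ofReal]
  congr 1
  push_cast
  have : ((‖besselVec hν τ‖ : ℝ) : ℂ) ≠ 0 := by exact_mod_cast hn τ
  field_simp

/-! ### The kernel, its Neumann series and its Gram form -/

lemma hasSum_of_forall_eq {f g : ℕ → ℂ} {a : ℂ} (h : ∀ n, f n = g n) (hg : HasSum g a) :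
    HasSum f a :=
  (funext h : f = g) ▸ hg

/-- The factor `(t / 2) ^ ν` of the Bessel functions `J_{ν + n}(t)`. -/
def besselPrefactor (ν t : ℝ) : ℂ := ((t : ℂ) / 2) ^ (ν : ℂ)

lemma besselPrefactor_ne_zero (ν : ℝ) {t : ℝ} (ht : t ≠ 0) : besselPrefactor ν t ≠ 0 := by
  simp [besselPrefactor, Complex.cpow_eq_zero_iff, ht]

/-- The terms of the series of the Gegenbauer-Bessel kernel. -/
def kernelTerm (ν : ℝ) (n : ℕ) (x t : ℝ) : ℂ :=
  neumannFactor ν n * besselJ (ν + n) (t : ℂ) * ((gegenbauerC ν n x : ℝ) : ℂ)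

/-- A majorant, uniform on `[-1, 1]`, of the series of the kernel. -/
def kernelMajorant (ν t : ℝ) (n : ℕ) : ℝ :=
  ‖neumannFactor ν n * besselJ (ν + n) (t : ℂ)‖ * (3 + 4 * ν) ^ n

lemma kernelMajorant_nonneg {ν : ℝ} (hν : 0 < ν) (t : ℝ) (n : ℕ) : 0 ≤ kernelMajorant ν t n := by
  unfold kernelMajorant
  positivity

lemma summable_kernelMajorant {ν : ℝ} (hν : 0 < ν) (t : ℝ) : Summable (kernelMajorant ν t) := by
  set B := 2 * (1 + 1 / (2 * ν)) with hB
  have hB0 : 0 ≤ B := by positivity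
  refine Summable.of_nonneg_of_le (kernelMajorant_nonneg hν t) (fun n => ?_)
    ((summable_geometric_mul_besselSeq hν (B * (3 + 4 * ν)) t (by positivity)).mul_left
      (3 * (ν + 1) * ‖besselPrefactor ν t‖))
  unfold kernelMajorant
  rw [besselJ_eq hν, ← besselPrefactor, norm_mul, norm_mul, Complex.norm_real, Real.norm_eq_abs]
  calc _ ≤ 3 * (ν + 1) * B ^ n * (‖besselPrefactor ν t‖ * |besselSeq ν n t|) * (3 + 4 * ν) ^ n := by
        gcongr
        exact norm_neumannFactor_le hν n
    _ = _ := by rw [mul_pow B]; ring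

lemma norm_kernelTerm_le {ν : ℝ} (hν : 0 < ν) (n : ℕ) {x : ℝ} (hx : |x| ≤ 1) (t : ℝ) :
    ‖kernelTerm ν n x t‖ ≤ kernelMajorant ν t n := by
  unfold kernelTerm kernelMajorant
  rw [norm_mul, Complex.norm_real, Real.norm_eq_abs]
  gcongr
  exact abs_gegenbauerC_le hν hx n

lemma norm_gegenbauerBesselKernel_le {ν : ℝ} (hν : 0 < ν) {x : ℝ} (hx : |x| ≤ 1) (t : ℝ) :
    ‖gegenbauerBesselKernel ν x t‖ ≤ ∑' n, kernelMajorant ν t n :=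
  tsum_of_norm_bounded (summable_kernelMajorant hν t).hasSum fun n => norm_kernelTerm_le hν n hx t

lemma aestronglyMeasurable_gegenbauerBesselKernel {ν : ℝ} (hν : 0 < ν) (t : ℝ) :
    AEStronglyMeasurable (fun x => gegenbauerBesselKernel ν x t) (gegenbauerMeasure ν) := by
  have hc : ContinuousOn (fun x => gegenbauerBesselKernel ν x t) (Set.Ioo (-1) 1) := by
    refine continuousOn_tsum (fun n => ?_) (summable_kernelMajorant hν t)
      (fun n x hx => norm_kernelTerm_le hν n (abs_le.2 ⟨hx.1.le, hx.2.le⟩) t)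
    have := continuous_gegenbauerC ν n
    fun_prop
  exact (hc.aestronglyMeasurable measurableSet_Ioo).mono_ac (withDensity_absolutelyContinuous _ _)

lemma integrable_mul_kernel {ν : ℝ} (hν : 0 < ν) {u : ℝ → ℂ}
    (hu : Integrable u (gegenbauerMeasure ν)) (t : ℝ) :
    Integrable (fun x => u x * gegenbauerBesselKernel ν x t) (gegenbauerMeasure ν) :=
  hu.mul_bdd (aestronglyMeasurable_gegenbauerBesselKernel hν t) (c := ∑' n, kernelMajorant ν t n)
    ((ae_gegenbauerMeasure_abs_le ν).mono fun _ hx => norm_gegenbauerBesselKernel_le hν hx t)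

/-- The Neumann series of the transform of an integrable function. -/
lemma hasSum_neumannSeries {ν : ℝ} (hν : 0 < ν) {u : ℝ → ℂ}
    (hu : Integrable u (gegenbauerMeasure ν)) (t : ℝ) :
    HasSum (fun n : ℕ => (neumannFactor ν n *
        ∫ x, u x * ((gegenbauerC ν n x : ℝ) : ℂ) ∂(gegenbauerMeasure ν)) * besselJ (ν + n) (t : ℂ))
      (∫ x, u x * gegenbauerBesselKernel ν x t ∂(gegenbauerMeasure ν)) := by
  have hmeas : ∀ n, Continuous fun x => kernelTerm ν n x t := fun n => by
    have := continuous_gegenbauerC ν n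
    unfold kernelTerm
    fun_prop
  have hbd : ∀ n, ∀ᵐ x ∂(gegenbauerMeasure ν), ‖kernelTerm ν n x t‖ ≤ kernelMajorant ν t n :=
    fun n => (ae_gegenbauerMeasure_abs_le ν).mono fun x hx => norm_kernelTerm_le hν n hx t
  have hint : ∀ n, Integrable (fun x => u x * kernelTerm ν n x t) (gegenbauerMeasure ν) :=
    fun n => hu.mul_bdd (hmeas n).aestronglyMeasurable (hbd n)
  have hsum : Summable fun n => ∫ x, ‖u x * kernelTerm ν n x t‖ ∂(gegenbauerMeasure ν) := by
    refine Summable.of_nonneg_of_le (fun n => integral_nonneg fun x => norm_nonneg _) (fun n => ?_)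
      ((summable_kernelMajorant hν t).mul_left (∫ x, ‖u x‖ ∂(gegenbauerMeasure ν)))
    rw [← integral_mul_const]
    refine integral_mono_ae (hint n).norm (hu.norm.mul_const _) ?_
    filter_upwards [hbd n] with x hx
    rw [norm_mul]
    gcongr
  have h := hasSum_integral_of_summable_integral_norm hint hsum
  simp only [tsum_mul_left] at h
  refine hasSum_of_forall_eq (fun n => ?_) h
  rw [← integral_const_mul, ← integral_mul_const]
  refine integral_congr_ae (Eventually.of_forall fun x => ?_)
  simp only [kernelTerm]
  ring

lemma integral_gegenbauerC_mul {ν : ℝ} (hν : 0 < ν) (m n : ℕ) :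
    ∫ x, gegenbauerC ν m x * gegenbauerC ν n x ∂(gegenbauerMeasure ν) =
      if m = n then gegenbauerNormSq hν n else 0 := by
  have e : ∫ x, gegenbauerC ν m x * gegenbauerC ν n x ∂(gegenbauerMeasure ν) =
      gegenbauerFunctional hν (gegenbauerPoly ν m * gegenbauerPoly ν n) := by
    simp only [gegenbauerFunctional_apply, Polynomial.eval_mul, gegenbauerPoly_eval]
  rw [e]
  split_ifs with h
  · rw [h, gegenbauerNormSq]
  · exact gegenbauerPoly_orthogonal hν h

lemma integral_gegenbauerC_mul_complex {ν : ℝ} (hν : 0 < ν) (m n : ℕ) :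
    ∫ x, ((gegenbauerC ν m x : ℝ) : ℂ) * ((gegenbauerC ν n x : ℝ) : ℂ) ∂(gegenbauerMeasure ν) =
      if m = n then (gegenbauerNormSq hν n : ℂ) else 0 := by
  simp only [← Complex.ofReal_mul]
  rw [integral_complex_ofReal, integral_gegenbauerC_mul hν]
  split_ifs <;> simp

/-- The Fourier-Gegenbauer coefficients of the kernel. -/
lemma integral_gegenbauerC_mul_kernel {ν : ℝ} (hν : 0 < ν) (n : ℕ) (s : ℝ) :
    ∫ x, ((gegenbauerC ν n x : ℝ) : ℂ) * gegenbauerBesselKernel ν x s ∂(gegenbauerMeasure ν) =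
      neumannFactor ν n * gegenbauerNormSq hν n * besselJ (ν + n) (s : ℂ) := by
  have hc : Continuous fun x => ((gegenbauerC ν n x : ℝ) : ℂ) := by
    have := continuous_gegenbauerC ν n
    fun_prop
  -- The transform of `u = C_n` itself: orthogonality leaves a single term of its Neumann series.
  have h := hasSum_neumannSeries hν (hc.integrable_gegenbauerMeasure hν) s
  simp only [integral_gegenbauerC_mul_complex hν] at h
  refine h.unique ?_
  have h' := hasSum_single (f := fun m : ℕ => (neumannFactor ν m *
    (if n = m then (gegenbauerNormSq hν m : ℂ) else 0)) * besselJ (ν + m) (s : ℂ)) n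
    (fun m hm => by rw [if_neg hm.symm]; ring)
  simpa using h'

/-- The constant which relates the Gegenbauer and the Bessel normalizations. -/
def kernelConst {ν : ℝ} (hν : 0 < ν) : ℝ := ν * gegenbauerNormSq hν 0

lemma kernelConst_pos {ν : ℝ} (hν : 0 < ν) : 0 < kernelConst hν :=
  mul_pos hν (gegenbauerNormSq_zero_pos hν)

/-- The squared modulus of `neumannFactor_mul_sqrt`; it is why `√(2(ν+n))` is the right weight for
`V(t)`. -/
lemma neumannFactor_mul_conj {ν : ℝ} (hν : 0 < ν) (n : ℕ) :
    neumannFactor ν n * (starRingEnd ℂ) (neumannFactor ν n) * gegenbauerNormSq hν n =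
      ((kernelConst hν * besselWeight ν n ^ 2 : ℝ) : ℂ) := by
  have h := neumannFactor_mul_sqrt hν n
  have h2 := congrArg (fun z => ‖z‖ ^ 2) h
  simp only [norm_mul, norm_pow, Complex.norm_I, one_pow, one_mul, Complex.norm_real, norm_mul,
    mul_pow, Real.norm_eq_abs, sq_abs] at h2
  rw [Real.sq_sqrt (gegenbauerNormSq_pos hν n).le, Real.sq_sqrt (by positivity),
    Real.sq_sqrt (mul_pos hν (gegenbauerNormSq_zero_pos hν)).le] at h2
  rw [Complex.mul_conj, Complex.normSq_eq_norm_sq, besselWeight_sq hν, kernelConst,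
    ← Complex.ofReal_mul, h2, mul_comm]

/-- The reproducing kernel as a Gram kernel in `ℓ²`. -/
lemma reproducingKernel_eq {ν : ℝ} (hν : 0 < ν) (t s : ℝ) :
    reproducingKernel ν t s = kernelConst hν * besselPrefactor ν t *
      (starRingEnd ℂ) (besselPrefactor ν s) * inner ℂ (besselVec hν t) (besselVec hν s) := by
  have := isFiniteMeasure_gegenbauerMeasure hν
  have hu : Integrable (fun x => (starRingEnd ℂ) (gegenbauerBesselKernel ν x s))
      (gegenbauerMeasure ν) := by
    refine Integrable.of_bound (Complex.continuous_conj.comp_aestronglyMeasurable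
      (aestronglyMeasurable_gegenbauerBesselKernel hν s)) (∑' n, kernelMajorant ν s n) ?_
    filter_upwards [ae_gegenbauerMeasure_abs_le ν] with x hx
    rw [RCLike.norm_conj]
    exact norm_gegenbauerBesselKernel_le hν hx s
  have hcoef : ∀ n : ℕ, ∫ x, (starRingEnd ℂ) (gegenbauerBesselKernel ν x s) *
      ((gegenbauerC ν n x : ℝ) : ℂ) ∂(gegenbauerMeasure ν) = (starRingEnd ℂ)
        (neumannFactor ν n * gegenbauerNormSq hν n * besselJ (ν + n) (s : ℂ)) := by
    intro n
    rw [← integral_gegenbauerC_mul_kernel, ← integral_conj]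
    refine integral_congr_ae (Eventually.of_forall fun x => ?_)
    simp only [map_mul, Complex.conj_ofReal]
    ring
  -- `k^ν(·, s)` is itself a transform, that of the conjugate of `K^ν(·, s)`.
  have h := hasSum_neumannSeries hν hu t
  simp only [hcoef] at h
  have e : reproducingKernel ν t s = ∫ x, (starRingEnd ℂ) (gegenbauerBesselKernel ν x s) *
      gegenbauerBesselKernel ν x t ∂(gegenbauerMeasure ν) :=
    integral_congr_ae (Eventually.of_forall fun x => mul_comm _ _)
  rw [e]
  refine h.unique ?_
  refine hasSum_of_forall_eq (fun n => ?_) ((lp.hasSum_inner (besselVec hν t) (besselVec hν s)).mul_left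
    (kernelConst hν * besselPrefactor ν t * (starRingEnd ℂ) (besselPrefactor ν s)))
  have hN := neumannFactor_mul_conj hν n
  rw [besselJ_eq hν, besselJ_eq hν, ← besselPrefactor, ← besselPrefactor, besselVec_apply,
    besselVec_apply]
  simp only [map_mul, Complex.conj_ofReal, RCLike.inner_apply, Complex.ofReal_mul]
  push_cast at hN
  linear_combination (besselPrefactor ν t * (starRingEnd ℂ) (besselPrefactor ν s) *
    besselSeq ν n t * besselSeq ν n s) * hN

lemma reproducingKernel_self {ν : ℝ} (hν : 0 < ν) (t : ℝ) :
    reproducingKernel ν t t =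
      ((kernelConst hν * ‖besselPrefactor ν t‖ ^ 2 * ‖besselVec hν t‖ ^ 2 : ℝ) : ℂ) := by
  rw [reproducingKernel_eq hν, mul_assoc (kernelConst hν : ℂ), Complex.mul_conj,
    Complex.normSq_eq_norm_sq, inner_self_eq_norm_sq_to_K]
  push_cast
  rfl

/-! ### The transform as an inner product in `ℓ²` -/

/-- The normalized Gegenbauer polynomials as elements of `L²`. -/
def gegenbauerLp {ν : ℝ} (hν : 0 < ν) (n : ℕ) : Lp ℂ 2 (gegenbauerMeasure ν) :=
  MemLp.toLp (fun x => (((Real.sqrt (gegenbauerNormSq hν n))⁻¹ * gegenbauerC ν n x : ℝ) : ℂ)) (by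
    have := isFiniteMeasure_gegenbauerMeasure hν
    have hc : Continuous fun x =>
        (((Real.sqrt (gegenbauerNormSq hν n))⁻¹ * gegenbauerC ν n x : ℝ) : ℂ) := by
      have := continuous_gegenbauerC ν n
      fun_prop
    refine MemLp.of_bound hc.aestronglyMeasurable
      ((Real.sqrt (gegenbauerNormSq hν n))⁻¹ * (3 + 4 * ν) ^ n) ?_
    filter_upwards [ae_gegenbauerMeasure_abs_le ν] with x hx
    rw [Complex.norm_real, norm_mul, Real.norm_of_nonneg (by positivity), Real.norm_eq_abs]
    gcongr
    exact abs_gegenbauerC_le hν hx n)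

lemma inner_gegenbauerLp_toLp {ν : ℝ} (hν : 0 < ν) (n : ℕ) {u : ℝ → ℂ}
    (hu : MemLp u 2 (gegenbauerMeasure ν)) :
    inner ℂ (gegenbauerLp hν n) (hu.toLp u) = (Real.sqrt (gegenbauerNormSq hν n) : ℂ)⁻¹ *
      ∫ x, u x * ((gegenbauerC ν n x : ℝ) : ℂ) ∂(gegenbauerMeasure ν) := by
  rw [L2.inner_def, ← integral_const_mul]
  unfold gegenbauerLp
  refine integral_congr_ae ?_
  filter_upwards [hu.coeFn_toLp, MemLp.coeFn_toLp (μ := gegenbauerMeasure ν) (p := 2)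
    (f := fun x => (((Real.sqrt (gegenbauerNormSq hν n))⁻¹ * gegenbauerC ν n x : ℝ) : ℂ)) _]
    with x h1 h2
  rw [h1, h2]
  simp only [RCLike.inner_apply, Complex.conj_ofReal]
  push_cast
  ring

lemma orthonormal_gegenbauerLp {ν : ℝ} (hν : 0 < ν) : Orthonormal ℂ (gegenbauerLp hν) := by
  rw [orthonormal_iff_ite]
  intro m n
  conv_lhs => rw [gegenbauerLp.eq_1 hν n]
  rw [inner_gegenbauerLp_toLp]
  have e : ∫ x, (((Real.sqrt (gegenbauerNormSq hν n))⁻¹ * gegenbauerC ν n x : ℝ) : ℂ) *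
      ((gegenbauerC ν m x : ℝ) : ℂ) ∂(gegenbauerMeasure ν) =
      (Real.sqrt (gegenbauerNormSq hν n) : ℂ)⁻¹ *
        if n = m then (gegenbauerNormSq hν m : ℂ) else 0 := by
    rw [← integral_gegenbauerC_mul_complex hν, ← integral_const_mul]
    refine integral_congr_ae (Eventually.of_forall fun x => ?_)
    push_cast
    ring
  rw [e]
  rcases eq_or_ne m n with rfl | h
  · have hp := gegenbauerNormSq_pos hν m
    have hs : (Real.sqrt (gegenbauerNormSq hν m) : ℂ) ≠ 0 := by
      exact_mod_cast (Real.sqrt_pos.2 hp).ne'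
    have hsq : (gegenbauerNormSq hν m : ℂ) = (Real.sqrt (gegenbauerNormSq hν m) : ℂ) ^ 2 := by
      exact_mod_cast (Real.sq_sqrt hp.le).symm
    rw [if_pos rfl, if_pos rfl]
    nth_rewrite 1 [hsq]
    field_simp
  · rw [if_neg h, if_neg h.symm, mul_zero, mul_zero]

/-- The sequence of the (rotated) normalized Fourier-Gegenbauer coefficients of `u`. -/
def gegenbauerCoeffs {ν : ℝ} (hν : 0 < ν) {u : ℝ → ℂ} (hu : MemLp u 2 (gegenbauerMeasure ν)) :
    SqSeq :=
  ⟨fun n => Complex.I ^ n * inner ℂ (gegenbauerLp hν n) (hu.toLp u), memℓp_gen (by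
    -- Bessel's inequality suffices; completeness of the Gegenbauer polynomials plays no role.
    simpa using (orthonormal_gegenbauerLp hν).inner_products_summable (x := hu.toLp u))⟩

lemma gegenbauerCoeffs_apply {ν : ℝ} (hν : 0 < ν) {u : ℝ → ℂ}
    (hu : MemLp u 2 (gegenbauerMeasure ν)) (n : ℕ) :
    gegenbauerCoeffs hν hu n = Complex.I ^ n * ((Real.sqrt (gegenbauerNormSq hν n) : ℂ)⁻¹ *
      ∫ x, u x * ((gegenbauerC ν n x : ℝ) : ℂ) ∂(gegenbauerMeasure ν)) := by
  rw [← inner_gegenbauerLp_toLp hν n hu]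
  rfl

/-- The transform of `u` as an inner product in `ℓ²`. -/
lemma integral_mul_kernel_eq {ν : ℝ} (hν : 0 < ν) {u : ℝ → ℂ}
    (hu : MemLp u 2 (gegenbauerMeasure ν)) (t : ℝ) :
    ∫ x, u x * gegenbauerBesselKernel ν x t ∂(gegenbauerMeasure ν) =
      besselPrefactor ν t * (Real.sqrt (kernelConst hν) : ℂ) *
        inner ℂ (besselVec hν t) (gegenbauerCoeffs hν hu) := by
  have := isFiniteMeasure_gegenbauerMeasure hν
  have h := hasSum_neumannSeries hν (hu.integrable (by norm_num)) t
  refine h.unique ?_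
  refine hasSum_of_forall_eq (fun n => ?_)
    ((lp.hasSum_inner (besselVec hν t) (gegenbauerCoeffs hν hu)).mul_left
      (besselPrefactor ν t * (Real.sqrt (kernelConst hν) : ℂ)))
  have hN := neumannFactor_mul_sqrt hν n
  have hs : (Real.sqrt (gegenbauerNormSq hν n) : ℂ) ≠ 0 := by
    exact_mod_cast (Real.sqrt_pos.2 (gegenbauerNormSq_pos hν n)).ne'
  rw [← besselWeight, ← kernelConst] at hN
  rw [besselJ_eq hν, ← besselPrefactor, gegenbauerCoeffs_apply, besselVec_apply]
  generalize ∫ x, u x * ((gegenbauerC ν n x : ℝ) : ℂ) ∂(gegenbauerMeasure ν) = a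
  simp only [RCLike.inner_apply, Complex.conj_ofReal]
  push_cast at hN ⊢
  field_simp
  linear_combination a * besselPrefactor ν t * besselSeq ν n t * hN

/-! ### The sampling series -/

/-- The terms of the sampling series, extended continuously to `s = 0`. -/
def samplingTerm {ν : ℝ} (hν : 0 < ν) (β : SqSeq) (t s : ℝ) : ℂ :=
  besselPrefactor ν t * (Real.sqrt (kernelConst hν) : ℂ) * inner ℂ (besselVec hν t)
    ((inner ℂ (besselVec hν s) β / (‖besselVec hν s‖ ^ 2 : ℝ)) • besselVec hν s)

/-- The powers of `s` in `f(s) k(t, s)` and in `k(s, s)` cancel, since both carry the prefactor and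
its conjugate. What is left makes sense, and is continuous, at `s = 0`. -/
lemma samplingTerm_eq {ν : ℝ} (hν : 0 < ν) (β : SqSeq) (t : ℝ) {s : ℝ} (hs : s ≠ 0) :
    besselPrefactor ν s * (Real.sqrt (kernelConst hν) : ℂ) * inner ℂ (besselVec hν s) β *
      (reproducingKernel ν t s / reproducingKernel ν s s) = samplingTerm hν β t s := by
  have hp := besselPrefactor_ne_zero ν hs
  have hp' : (starRingEnd ℂ) (besselPrefactor ν s) ≠ 0 := by simpa using hp
  have hc : (kernelConst hν : ℂ) ≠ 0 := by exact_mod_cast (kernelConst_pos hν).ne'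
  have hV : ((‖besselVec hν s‖ : ℝ) : ℂ) ≠ 0 := by
    exact_mod_cast norm_ne_zero_iff.2 (besselVec_ne_zero hν s)
  have e : inner ℂ (besselVec hν s) (besselVec hν s) = ((‖besselVec hν s‖ : ℝ) : ℂ) ^ 2 :=
    inner_self_eq_norm_sq_to_K _
  rw [reproducingKernel_eq hν, reproducingKernel_eq hν, e, samplingTerm, inner_smul_right]
  push_cast
  field_simp

lemma continuous_samplingTerm {ν : ℝ} (hν : 0 < ν) (β : SqSeq) (t : ℝ) :
    Continuous (samplingTerm hν β t) := by
  have hc := continuous_besselVec hν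
  have hne : ∀ s, ((‖besselVec hν s‖ ^ 2 : ℝ) : ℂ) ≠ 0 := fun s => by
    exact_mod_cast pow_ne_zero 2 (norm_ne_zero_iff.2 (besselVec_ne_zero hν s))
  unfold samplingTerm
  refine continuous_const.mul (Continuous.inner continuous_const (Continuous.smul
    (Continuous.div (hc.inner continuous_const) ?_ hne) hc))
  exact Complex.continuous_ofReal.comp (hc.norm.pow 2)

/-- Identifies the Cauchy-Schwarz constant of the evaluation at `t`, through which boundedness of
`k^ν(t, t)` gives uniform convergence. -/
lemma sq_norm_prefactor_mul_norm_besselVec {ν : ℝ} (hν : 0 < ν) (t : ℝ) :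
    (‖besselPrefactor ν t * (Real.sqrt (kernelConst hν) : ℂ)‖ * ‖besselVec hν t‖) ^ 2 =
      ‖reproducingKernel ν t t‖ := by
  have hc := kernelConst_pos hν
  rw [reproducingKernel_self hν, Complex.norm_real, Real.norm_of_nonneg (by positivity), norm_mul,
    Complex.norm_real, mul_pow, mul_pow, Real.norm_eq_abs, sq_abs, Real.sq_sqrt hc.le]
  ring

end

theorem theorem4 (ν : ℝ) (hν : 0 < ν) (u : ℝ → ℂ) (hu : MemLp u 2 (gegenbauerMeasure ν))
    (f : ℝ → ℂ)
    (hf : ∀ t : ℝ, f t = ∫ x, u x * gegenbauerBesselKernel ν x t ∂(gegenbauerMeasure ν)) :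
    -- the integral that defines `f` converges
    (∀ t : ℝ, Integrable (fun x => u x * gegenbauerBesselKernel ν x t) (gegenbauerMeasure ν)) ∧
    -- the Neumann series
    (∀ t : ℝ, HasSum
      (fun n : ℕ =>
        (neumannFactor ν n * ∫ x, u x * ((gegenbauerC ν n x : ℝ) : ℂ) ∂(gegenbauerMeasure ν)) *
          besselJ (ν + n) (t : ℂ))
      (f t)) ∧
    -- the sampling expansion over all real zeros of `J_ν`; the term at the origin is a limit
    (∀ s : ℝ, s ≠ 0 → reproducingKernel ν s s ≠ 0) ∧
    ∃ f₀ : ℝ → ℂ,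
      (∀ t : ℝ, Tendsto
        (fun s : ℝ => f s * (reproducingKernel ν t s / reproducingKernel ν s s))
        (𝓝[≠] 0) (𝓝 (f₀ t))) ∧
      (∀ t : ℝ, HasSum
        (fun τ : besselZeros ν =>
          if (τ : ℝ) = 0 then f₀ t
          else f τ * (reproducingKernel ν t τ / reproducingKernel ν τ τ))
        (f t)) ∧
      (∀ S : Set ℝ, (∃ M : ℝ, ∀ t ∈ S, ‖reproducingKernel ν t t‖ ≤ M) →
        TendstoUniformlyOn
          (fun (A : Finset (besselZeros ν)) (t : ℝ) => ∑ τ ∈ A,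
            if (τ : ℝ) = 0 then f₀ t
            else f τ * (reproducingKernel ν t τ / reproducingKernel ν τ τ))
          f atTop S) := by
  have hfin := isFiniteMeasure_gegenbauerMeasure hν
  have hint := hu.integrable (by norm_num : (1 : ENNReal) ≤ 2)
  set β := gegenbauerCoeffs hν hu
  have hfβ : ∀ t, f t = besselPrefactor ν t * (Real.sqrt (kernelConst hν) : ℂ) *
      inner ℂ (besselVec hν t) β := fun t => (hf t).trans (integral_mul_kernel_eq hν hu t)
  have hterm : ∀ t : ℝ, ∀ τ : besselZeros ν, (if (τ : ℝ) = 0 then samplingTerm hν β t 0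
      else f τ * (reproducingKernel ν t τ / reproducingKernel ν τ τ)) =
      samplingTerm hν β t τ := by
    intro t τ
    split_ifs with h
    · rw [h]
    · rw [hfβ, samplingTerm_eq hν β t h]
  have hβ := hasSum_besselVec hν β
  refine ⟨integrable_mul_kernel hν hint, fun t => ?_, fun s hs => ?_,
    fun t => samplingTerm hν β t 0, fun t => ?_, fun t => ?_, fun S ⟨M, hM⟩ => ?_⟩
  · rw [hf t]
    exact hasSum_neumannSeries hν hint t
  · rw [reproducingKernel_self hν, Complex.ofReal_ne_zero]
    have := norm_ne_zero_iff.2 (besselVec_ne_zero hν s)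
    have := norm_ne_zero_iff.2 (besselPrefactor_ne_zero ν hs)
    have := (kernelConst_pos hν).ne'
    positivity
  · refine (((continuous_samplingTerm hν β t).tendsto 0).mono_left nhdsWithin_le_nhds).congr' ?_
    filter_upwards [self_mem_nhdsWithin] with s hs
    rw [hfβ, samplingTerm_eq hν β t hs]
  · simp only [hterm]
    rw [hfβ t]
    -- The continuous functional `⟨V(t), ·⟩` is applied to the expansion of `β`.
    exact ((innerSL ℂ (besselVec hν t)).hasSum hβ).mul_left _
  · simp only [hterm]
    rw [Metric.tendstoUniformlyOn_iff]
    intro ε hε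
    -- The `ℓ²` error of the partial sums does not involve `t`; all dependence on `t` is absorbed in
    -- `√M`.
    have hlim := (tendsto_iff_norm_sub_tendsto_zero.1 hβ).const_mul (Real.sqrt M)
    rw [mul_zero] at hlim
    filter_upwards [hlim.eventually_lt_const hε] with A hA t ht
    refine lt_of_le_of_lt ?_ hA
    simp only [samplingTerm]
    rw [dist_comm, dist_eq_norm, hfβ t, ← Finset.mul_sum, ← inner_sum, ← mul_sub, ← inner_sub_right,
      norm_mul]
    have hsq : ‖besselPrefactor ν t * (Real.sqrt (kernelConst hν) : ℂ)‖ * ‖besselVec hν t‖ ≤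
        Real.sqrt M := by
      refine Real.le_sqrt_of_sq_le ?_
      rw [sq_norm_prefactor_mul_norm_besselVec]
      exact hM t ht
    calc _ ≤ ‖besselPrefactor ν t * (Real.sqrt (kernelConst hν) : ℂ)‖ *
          (‖besselVec hν t‖ * _) := by
          gcongr
          exact norm_inner_le_norm _ _
      _ ≤ _ := by
          rw [← mul_assoc]
          gcongr
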